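/- **Setting.** Let $n\ge 1$. Write $\mathfrak R^n$ for the family of compact sets $\Omega\subset\mathbb R^n$ whose interior $\Omega^\circ$ is a connected open neighbourhood of $0$ and with $\Omega=\overline{\Omega^\circ}$. Consider $\dot x=g(x,u)$, $x\in\mathcal X\in\mathfrak R^n$, $u\in\mathcal U\in\mathfrak R^m$, $g(0,0)=0$. Let $\mathcal T=\{\sigma_i\}_{i=1}^{m_{\mathcal T}}$ be a finite collection of distinct $n$-simplexes $\sigma_i=\mathrm{co}\{x_{i,0},\dots,x_{i,n}\}$, any two of which meet in a common face or not at all, whose union (also denoted $\mathcal T$) belongs to $\mathfrak R^n$ and is contained in $\mathcal X$; if $0\in\sigma_i$, then $x_{i,0}=0$. Let $\mathbb E_{\mathcal T}$ be the set of all vertices. A function is piecewise $C^2$ on $\mathcal T$ if it is continuous on $\mathcal T$ and $C^2$ on each closed simplex $\sigma_i$. Let $\{u(\cdot,\lambda)\}_{\lambda}$ be a class of controllers such that for every $\lambda$: $u(0,\lambda)=0$; $u(\cdot,\lambda)$ and $g_\lambda:=g(\cdot,u(\cdot,\lambda))$ are Lipschitz and piecewise $C^2$ on $\mathcal T$; and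 if $u(x,\lambda)\in\mathcal U$ for all $x\in\mathbb E_{\mathcal T}$, then $u(x,\lambda)\in\mathcal U$ for all $x\in\mathcal T$. Suppose that some $\lambda$ satisfies $u(x,\lambda)\in\mathcal U$ for all $x\in\mathbb E_{\mathcal T}$. **The program.** For given nodal values $\mathbf V=\{V_x\}_{x\in\mathbb E_{\mathcal T}}$ with continuous piecewise affine (CPA) interpolation $V:\mathcal T\to\mathbb R$ (affine on each $\sigma_i$, with gradient $\nabla V_i$ there), vectors $l_i\in\mathbb R^n$ and a parameter $\lambda$, put $$D^+_{i,j}V=g_\lambda(x_{i,j})^{\top}\nabla V_i+c_{i,j}\,\beta_i\,\mathbf 1^{\top}l_i,\qquad c_{i,j}=\tfrac n2\|x_{i,j}-x_{i,0}\|\Bigl(\max_{1\le k\le n}\|x_{i,k}-x_{i,0}\|+\|x_{i,j}-x_{i,0}\|\Bigr),$$ where $\beta_i=\beta_i(\lambda)$ is an upper bound, for every $\lambda$ admissible at the vertices, of $\bigl|\partial^2 g^{(p)}_\lambda/\partial x^{(q)}\partial x^{(r)}\bigr|$ on $\sigma_i$ (derivatives within $\sigma_i$) for all $p,q,r$. Let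 $(\mathbf V^*,\mathbf L^*,\lambda^*,a^*,b_1^*,b_2^*)$ minimize a given real cost function over all $(\mathbf V,\mathbf L=\{l_i\},\lambda,a,b_1,b_2)$ subject to: $V_0=0$; $a,b_1>0$; $b_1\|x\|^a\le V_x$ for $x\in\mathbb E_{\mathcal T}\setminus\{0\}$; $|\nabla V_i|\le l_i$ componentwise; $u(x_{i,j},\lambda)\in\mathcal U$; and $D^+_{i,j}V\le -b_2V_{x_{i,j}}$ for all $i,j$. **Statement.** Suppose $b_2^*\le 0$. Let $\mathbb I_1$ be the set of all $i$ with $D^+_{i,j}V^*<0$ for every $j$ such that $x_{i,j}\ne0$, and let $\mathcal E_1=\bigcup_{i\in\mathbb I_1}\sigma_i$. Suppose that $i\in\mathbb I_1$ whenever $0\in\sigma_i$. Then: 1. The minimum $\hat b_2^*:=\min\{-D^+_{i,j}V^*/V^*_{x_{i,j}} : i\in\mathbb I_1,\ 0\le j\le n,\ x_{i,j}\neq0\}$ exists and is positive, and some subcollection of $\{\sigma_i\}_{i\in\mathbb I_1}$ has its union $\hat{\mathcal E}_1$ in $\mathfrak R^n$. 2. The origin is a locally exponentially stable equilibrium of $\dot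 x=g_{\lambda^*}(x)$. 3. Let $\hat{\mathcal E}_1\subseteq\mathcal E_1$ be any set in $\mathfrak R^n$. Then $V^*$ is a Lyapunov function of $\dot x=g_{\lambda^*}(x)$ on $\hat{\mathcal E}_1$: it is Lipschitz on $\hat{\mathcal E}_1$, $V^*(0)=0$, there are $a,b_1>0$ with $b_1\|x\|^{a}\le V^*(x)$ on $\hat{\mathcal E}_1$, and $$D^+V^*(x):=\limsup_{h\to0^+}\frac{V^*(x+hg_{\lambda^*}(x))-V^*(x)}{h}\le-\hat b_2^*V^*(x)$$ for all $x\in\hat{\mathcal E}_1^\circ\setminus\{0\}$. If $a^*\ge1$, one may take $a=a^*$, $b_1=b_1^*$. 4. Let moreover $r>0$ be such that $\mathcal A=\{x\in\hat{\mathcal E}_1: 0\le V^*(x)\le r\}$ is in $\mathfrak R^n$. Let $x(\cdot)$ be a solution of $\dot x=g_{\lambda^*}(x)$ on $[t_0,t_1]$ with $x(t_0)\in\mathcal A^\circ$ that stays in $\hat{\mathcal E}_1$. Then, for $t\in[t_0,t_1]$, $V^*(x(t))\le r\,e^{-\hat b_2^*(t-t_0)}$ and, if $a^*\ge1$, $$\|x(t)\|\le\sqrt[a^*]{r/b_1^*}\;e^{-(\hat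 b_2^*/a^*)(t-t_0)}.$$ If in addition $V^*=r$ on $\partial\mathcal A$ (for instance if $\mathcal A\subset\hat{\mathcal E}_1^\circ$), then from every $x_0\in\mathcal A^\circ$ at every time $t_0$ there is a solution on $[t_0,\infty)$, and every solution starting at $x_0$ stays in $\mathcal A^\circ$ and satisfies these estimates for as long as it is defined, hence for all $t\ge t_0$ if it is defined on $[t_0,\infty)$. -/

import Mathlib

open Set Filter Topology

noncomputable section

/-- Euclidean space `ℝⁿ` with the Euclidean norm. -/
abbrev E (n : ℕ) : Type := EuclideanSpace ℝ (Fin n)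

/-- The family `ℜⁿ`: compact sets whose interior is a connected open neighbourhood of the origin
and which are the closure of their interior. -/
structure IsRegion {n : ℕ} (Ω : Set (E n)) : Prop where
  isCompact : IsCompact Ω
  zero_mem : (0 : E n) ∈ interior Ω
  isConnected : IsConnected (interior Ω)
  closure_interior : closure (interior Ω) = Ω

/-- A triangulation: a finite collection of `m` distinct `n`-simplexes in `ℝⁿ`, any two of which
meet in a common face or not at all, whose union is a region. A simplex containing the origin
has the origin as its vertex number `0`. -/
structure Triangulation (n : ℕ) where
  m : ℕ
  vertex : Fin m → Fin (n + 1) → E n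
  affineIndependent : ∀ i, AffineIndependent ℝ (vertex i)
  distinct : Function.Injective fun i => convexHull ℝ (range (vertex i))
  inter_face : ∀ i k, convexHull ℝ (range (vertex i)) ∩ convexHull ℝ (range (vertex k)) =
    convexHull ℝ (range (vertex i) ∩ range (vertex k))
  origin_vertex : ∀ i, (0 : E n) ∈ convexHull ℝ (range (vertex i)) → vertex i 0 = 0
  isRegion : IsRegion (⋃ i, convexHull ℝ (range (vertex i)))

namespace Triangulation

variable {n : ℕ} (T : Triangulation n)

/-- The simplex `σ_i`. -/
def simplex (i : Fin T.m) : Set (E n) := convexHull ℝ (range (T.vertex i))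

/-- The union of the simplexes with index in `I`. -/
def union (I : Set (Fin T.m)) : Set (E n) := ⋃ i ∈ I, T.simplex i

/-- The set of points of the triangulation. -/
def carrier : Set (E n) := ⋃ i, T.simplex i

/-- The set of all vertices of the triangulation. -/
def vertexSet : Set (E n) := {x | ∃ i j, T.vertex i j = x}

/-- `x_{i,j}` as an element of the vertex set. -/
def node (i : Fin T.m) (j : Fin (n + 1)) : T.vertexSet := ⟨T.vertex i j, i, j, rfl⟩

/-- The matrix `X_i` with rows `x_{i,j} - x_{i,0}`, `j = 1, …, n`. -/
def edgeMatrix (i : Fin T.m) : Matrix (Fin n) (Fin n) ℝ :=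
  Matrix.of fun j k => (T.vertex i j.succ - T.vertex i 0) k

/-- The gradient `∇W_i = X_i⁻¹ W̄_i` on `σ_i` of the interpolation of the nodal values `W`. -/
def grad (W : T.vertexSet → ℝ) (i : Fin T.m) : E n :=
  WithLp.toLp 2 ((T.edgeMatrix i)⁻¹.mulVec fun j => W (T.node i j.succ) - W (T.node i 0))

/-- The affine function with gradient `∇W_i` and value `W_{x_{i,0}}` at `x_{i,0}`. -/
def affinePiece (W : T.vertexSet → ℝ) (i : Fin T.m) (x : E n) : ℝ :=
  W (T.node i 0) + inner ℝ (T.grad W i) (x - T.vertex i 0)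

open Classical in
/-- The continuous piecewise affine interpolation of the nodal values `W`
(extended by `0` outside the triangulation). By `cpa_eq_affinePiece` below the value does not
depend on the simplex used to compute it. -/
def cpa (W : T.vertexSet → ℝ) (x : E n) : ℝ :=
  if h : ∃ i, x ∈ T.simplex i then T.affinePiece W h.choose x else 0

lemma affinePiece_vertex (W : T.vertexSet → ℝ) (i : Fin T.m) (j : Fin (n + 1)) :
    T.affinePiece W i (T.vertex i j) = W (T.node i j) := by
  refine Fin.cases (by simp [affinePiece]) (fun j => ?_) j
  have hli : LinearIndependent ℝ (T.edgeMatrix i).row := by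
    have h := (affineIndependent_iff_linearIndependent_vsub ℝ _ (0 : Fin (n + 1))).1
      (T.affineIndependent i)
    have h2 := h.comp (fun k : Fin n => (⟨k.succ, Fin.succ_ne_zero k⟩ : {x : Fin (n + 1) // x ≠ 0}))
      (fun a b hab => Fin.succ_injective _ (congrArg Subtype.val hab))
    exact h2.map' (WithLp.linearEquiv 2 ℝ (Fin n → ℝ)).toLinearMap (LinearEquiv.ker _)
  have hu := Matrix.linearIndependent_rows_iff_isUnit.1 hli
  have hd : IsUnit (T.edgeMatrix i).det := (Matrix.isUnit_iff_isUnit_det _).1 hu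
  have key : (T.edgeMatrix i).mulVec ((T.edgeMatrix i)⁻¹.mulVec
      fun j => W (T.node i j.succ) - W (T.node i 0)) j = W (T.node i j.succ) - W (T.node i 0) := by
    rw [Matrix.mulVec_mulVec, Matrix.mul_nonsing_inv _ hd, Matrix.one_mulVec]
  have : inner ℝ (T.grad W i) (T.vertex i j.succ - T.vertex i 0) =
      W (T.node i j.succ) - W (T.node i 0) := by
    rw [← key]
    simp [grad, PiLp.inner_apply, Matrix.mulVec, dotProduct, edgeMatrix]
  rw [affinePiece, this]
  ring

lemma cpa_eq_affinePiece (W : T.vertexSet → ℝ) (i : Fin T.m) {x : E n} (hx : x ∈ T.simplex i) :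
    T.cpa W x = T.affinePiece W i x := by
  have h : ∃ i, x ∈ T.simplex i := ⟨i, hx⟩
  rw [cpa, dif_pos h]
  generalize hk : h.choose = k
  have hxk : x ∈ T.simplex k := hk ▸ h.choose_spec
  have hx' : x ∈ convexHull ℝ (range (T.vertex k) ∩ range (T.vertex i)) := by
    rw [← T.inter_face k i]; exact ⟨hxk, hx⟩
  have hconv : Convex ℝ {z | T.affinePiece W k z = T.affinePiece W i z} := by
    intro y hy z hz s t _ _ hst
    simp only [mem_ofPred_eq, affinePiece, inner_sub_right, inner_add_right,
      inner_smul_right] at hy hz ⊢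
    obtain rfl : s = 1 - t := by linarith
    linear_combination (1 - t) * hy + t * hz
  refine convexHull_min ?_ hconv hx'
  rintro v ⟨⟨j, rfl⟩, l, hl⟩
  have hn : T.node k j = T.node i l := Subtype.ext hl.symm
  rw [mem_ofPred_eq, affinePiece_vertex, hn, ← hl, affinePiece_vertex]

/-- The constant
`c_{i,j} = (n/2) ‖x_{i,j} - x_{i,0}‖ (max_{1 ≤ k ≤ n} ‖x_{i,k} - x_{i,0}‖ + ‖x_{i,j} - x_{i,0}‖)`. -/
def c (i : Fin T.m) (j : Fin (n + 1)) : ℝ :=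
  (n : ℝ) / 2 * ‖T.vertex i j - T.vertex i 0‖ *
    ((⨆ k : Fin n, ‖T.vertex i k.succ - T.vertex i 0‖) + ‖T.vertex i j - T.vertex i 0‖)

/-- Piecewise `C²` functions: continuous, and `C²` on each (closed) simplex. -/
def PiecewiseC2 {k : ℕ} (f : E n → E k) : Prop :=
  ContinuousOn f T.carrier ∧ ∀ i, ContDiffOn ℝ 2 f (T.simplex i)

/-- The second partial derivative `∂²f⁽ᵖ⁾/∂x⁽ᑫ⁾∂x⁽ʳ⁾` at `ξ ∈ σ_i`, taken within `σ_i`. -/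
def secondPartial (f : E n → E n) (i : Fin T.m) (p q r : Fin n) (ξ : E n) : ℝ :=
  iteratedFDerivWithin ℝ 2 (fun y => f y p) (T.simplex i) ξ
    ![EuclideanSpace.single q 1, EuclideanSpace.single r 1]

end Triangulation

/-- The closed-loop vector field `g_λ(x) = g(x, u(x, λ))`. -/
def closedLoop {n m : ℕ} {Λ : Type*} (g : E n → E m → E n) (u : Λ → E n → E m) (lam : Λ) :
    E n → E n := fun x => g x (u lam x)

/-- The standing assumptions on a class `u(·, λ)`, `λ ∈ Λ`, of state feedback controllers on a
triangulation, for the system `ẋ = g(x, u)` with input constraint set `U`. -/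
structure ControllerClass {n m : ℕ} {Λ : Type*} (T : Triangulation n) (g : E n → E m → E n)
    (U : Set (E m)) (u : Λ → E n → E m) : Prop where
  lipschitz : ∀ lam, ∃ K, LipschitzOnWith K (u lam) T.carrier
  zero : ∀ lam, u lam 0 = 0
  lipschitz_closedLoop : ∀ lam, ∃ K, LipschitzOnWith K (closedLoop g u lam) T.carrier
  piecewiseC2 : ∀ lam, T.PiecewiseC2 (u lam)
  piecewiseC2_closedLoop : ∀ lam, T.PiecewiseC2 (closedLoop g u lam)
  admissible_of_vertices : ∀ lam, (∀ x ∈ T.vertexSet, u lam x ∈ U) → ∀ x ∈ T.carrier, u lam x ∈ U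
  exists_admissible : ∃ lam, ∀ x ∈ T.vertexSet, u lam x ∈ U

/-- `β_i(λ)` bounds all second partial derivatives of `g_λ` on `σ_i`, for every `λ` whose
controller is admissible at all the vertices. -/
def IsHessianBound {n m : ℕ} {Λ : Type*} (T : Triangulation n) (g : E n → E m → E n)
    (U : Set (E m)) (u : Λ → E n → E m) (β : Λ → Fin T.m → ℝ) : Prop :=
  ∀ lam, (∀ i j, u lam (T.vertex i j) ∈ U) → ∀ i, ∀ p q r : Fin n, ∀ ξ ∈ T.simplex i,
    |T.secondPartial (closedLoop g u lam) i p q r ξ| ≤ β lam i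

/-- The decision variables `(V, L, λ, a, b₁, b₂)` of the nonlinear program. -/
structure Decision {n : ℕ} (T : Triangulation n) (Λ : Type*) where
  V : T.vertexSet → ℝ
  l : Fin T.m → Fin n → ℝ
  lam : Λ
  a : ℝ
  b₁ : ℝ
  b₂ : ℝ

namespace Decision

variable {n m : ℕ} {Λ : Type*} {T : Triangulation n}

/-- `D⁺_{i,j} V = g_λ(x_{i,j})ᵀ ∇V_i + c_{i,j} β_i 1ᵀ l_i`. -/
def dPlus (g : E n → E m → E n) (u : Λ → E n → E m) (β : Λ → Fin T.m → ℝ) (y : Decision T Λ)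
    (i : Fin T.m) (j : Fin (n + 1)) : ℝ :=
  inner ℝ (closedLoop g u y.lam (T.vertex i j)) (T.grad y.V i) +
    T.c i j * β y.lam i * ∑ k, y.l i k

/-- The constraints of the nonlinear program. -/
structure Feasible (g : E n → E m → E n) (U : Set (E m)) (u : Λ → E n → E m)
    (β : Λ → Fin T.m → ℝ) (y : Decision T Λ) : Prop where
  V_zero : ∀ x : T.vertexSet, (x : E n) = 0 → y.V x = 0
  a_pos : 0 < y.a
  b₁_pos : 0 < y.b₁
  lower : ∀ x : T.vertexSet, (x : E n) ≠ 0 → y.b₁ * ‖(x : E n)‖ ^ y.a ≤ y.V x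
  grad_le : ∀ i k, |T.grad y.V i k| ≤ y.l i k
  input_mem : ∀ i j, u y.lam (T.vertex i j) ∈ U
  decrease : ∀ i j, y.dPlus g u β i j ≤ -y.b₂ * y.V (T.node i j)

/-- `y` is an optimal solution of the nonlinear program with cost function `J`. -/
def IsOptimal (g : E n → E m → E n) (U : Set (E m)) (u : Λ → E n → E m)
    (β : Λ → Fin T.m → ℝ) (J : Decision T Λ → ℝ) (y : Decision T Λ) : Prop :=
  y.Feasible g U u β ∧ ∀ z : Decision T Λ, z.Feasible g U u β → J y ≤ J z

/-- The index set `𝕀₁`: simplexes with `D⁺_{i,j} V < 0` at all their nonzero vertices. -/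
def goodSimplexes (g : E n → E m → E n) (u : Λ → E n → E m) (β : Λ → Fin T.m → ℝ)
    (y : Decision T Λ) : Set (Fin T.m) :=
  {i | ∀ j, T.vertex i j ≠ 0 → y.dPlus g u β i j < 0}

/-- The set `{-D⁺_{i,j} V / V_{x_{i,j}} | i ∈ 𝕀₁, 0 ≤ j ≤ n, x_{i,j} ≠ 0}`. -/
def decayRates (g : E n → E m → E n) (u : Λ → E n → E m) (β : Λ → Fin T.m → ℝ)
    (y : Decision T Λ) : Set ℝ :=
  {s | ∃ i ∈ y.goodSimplexes g u β, ∃ j, T.vertex i j ≠ 0 ∧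
    s = -y.dPlus g u β i j / y.V (T.node i j)}

end Decision

/-- The Dini derivative `D⁺W(x) = limsup_{h → 0⁺} (W(x + h f(x)) - W(x)) / h`. -/
def diniDeriv {n : ℕ} (f : E n → E n) (W : E n → ℝ) (x : E n) : EReal :=
  limsup (fun h : ℝ => (((W (x + h • f x) - W x) / h : ℝ) : EReal)) (𝓝[>] (0 : ℝ))

/-- `W` is a (Lipschitz) Lyapunov function on `Ω` of `ẋ = f(x)` with constants `a, b₁, b₂`. -/
structure IsLyapunov {n : ℕ} (f : E n → E n) (Ω : Set (E n)) (W : E n → ℝ) (a b₁ b₂ : ℝ) :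
    Prop where
  lipschitz : ∃ K, LipschitzOnWith K W Ω
  zero : W 0 = 0
  a_pos : 0 < a
  b₁_pos : 0 < b₁
  b₂_pos : 0 < b₂
  lower : ∀ x ∈ Ω, b₁ * ‖x‖ ^ a ≤ W x
  decrease : ∀ x ∈ interior Ω \ {0}, diniDeriv f W x ≤ ((-b₂ * W x : ℝ) : EReal)

/-- `x` solves `ẋ = f(x)` on the time interval `J`. -/
def IsSolutionOn {n : ℕ} (f : E n → E n) (x : ℝ → E n) (J : Set ℝ) : Prop :=
  ∀ t ∈ J, HasDerivWithinAt x (f (x t)) J t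

/-- The origin is a locally exponentially stable equilibrium of `ẋ = f(x)`. -/
def LocallyExponentiallyStable {n : ℕ} (f : E n → E n) : Prop :=
  f 0 = 0 ∧ ∃ δ > 0, ∃ C > 0, ∃ α > 0, ∀ (t₀ : ℝ) (x₀ : E n), ‖x₀‖ < δ →
    (∃ x : ℝ → E n, x t₀ = x₀ ∧ IsSolutionOn f x (Ici t₀)) ∧
    ∀ (t₁ : ℝ) (x : ℝ → E n), x t₀ = x₀ → IsSolutionOn f x (Icc t₀ t₁) →
      ∀ t ∈ Icc t₀ t₁, ‖x t‖ ≤ C * ‖x₀‖ * Real.exp (-α * (t - t₀))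

end

/-! On one simplex `V` is affine, so its orbital derivative at `x` is the inner product of `g_λ(x)`
with a constant gradient. By Taylor's formula `g_λ(x)` differs, coordinate by coordinate, from the
barycentric interpolation of its vertex values by at most `β_i` times the interpolation of the
`c_{i,j}`. As `l_i` dominates the gradient, the orbital derivative is at most the interpolation of
the `D⁺_{i,j} V` (`Decision.inner_grad_le_sum_dPlus`). On good simplexes these numbers are at most
`-b V` at the vertices, where `b` is the least of finitely many positive ratios, and `V` is its own
interpolation. Hence the orbital derivative is at most `-b V` throughout every good simplex
(`Decision.inner_grad_le`).

Across faces `V` is not differentiable. However, points near `x` lie only in simplexes containing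
`x`, and there are finitely many of these, so every right difference quotient along a curve is
controlled by the gradients at `x` (`DecaysOn.eventually_slope_lt`). This yields the Dini
inequality, and Grönwall's lemma turns it into exponential decay along solutions
(`DecaysOn.cpa_le`). A first-exit argument gives invariance (`DecaysOn.mem_of_solution`). A global
Lipschitz extension of the field then gives existence for all future time.

Stability needs linear bounds on `V` from both sides. The lower one comes from the finitely many
vertex values by convexity of the norm. The upper one is Lipschitz continuity of `V` on the
triangulation, which is not convex; the proof compares two simplexes through the weight of their
non-common vertices (`exists_freeWeight_le`). The region required in the first claim is the star of
the origin. -/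

noncomputable section

/-! ### Barycentric coordinates and affine pieces -/

namespace Triangulation

variable {n : ℕ} (T : Triangulation n)

/-- The vertices of the simplex `σ_i` as an affine basis of `ℝⁿ`. -/
def basis (i : Fin T.m) : AffineBasis (Fin (n + 1)) ℝ (E n) where
  toFun := T.vertex i
  ind' := T.affineIndependent i
  tot' := by
    rw [(T.affineIndependent i).affineSpan_eq_top_iff_card_eq_finrank_add_one]
    simp

/-- The barycentric coordinates with respect to the vertices of `σ_i`. -/
abbrev bary (i : Fin T.m) (j : Fin (n + 1)) : E n →ᵃ[ℝ] ℝ := (T.basis i).coord j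

lemma sum_bary (i : Fin T.m) (x : E n) : ∑ j, T.bary i j x = 1 :=
  (T.basis i).sum_coord_apply_eq_one x

lemma sum_bary_smul (i : Fin T.m) (x : E n) : ∑ j, T.bary i j x • T.vertex i j = x :=
  (T.basis i).linear_combination_coord_eq_self x

lemma continuous_bary (i : Fin T.m) (j : Fin (n + 1)) : Continuous (T.bary i j) :=
  continuous_barycentric_coord _ _

lemma simplex_eq (i : Fin T.m) : T.simplex i = {x | ∀ j, 0 ≤ T.bary i j x} :=
  (T.basis i).convexHull_eq_nonneg_coord

lemma mem_simplex {i : Fin T.m} {x : E n} : x ∈ T.simplex i ↔ ∀ j, 0 ≤ T.bary i j x := by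
  rw [simplex_eq]; rfl

lemma vertex_mem (i : Fin T.m) (j : Fin (n + 1)) : T.vertex i j ∈ T.simplex i :=
  subset_convexHull ℝ _ (mem_range_self j)

lemma convex_simplex (i : Fin T.m) : Convex ℝ (T.simplex i) := convex_convexHull ℝ _

lemma isCompact_simplex (i : Fin T.m) : IsCompact (T.simplex i) :=
  (finite_range _).isCompact_convexHull ℝ

lemma isClosed_simplex (i : Fin T.m) : IsClosed (T.simplex i) := (T.isCompact_simplex i).isClosed

lemma simplex_subset_carrier (i : Fin T.m) : T.simplex i ⊆ T.carrier :=
  subset_iUnion T.simplex i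

lemma interior_simplex_nonempty (i : Fin T.m) : (interior (T.simplex i)).Nonempty :=
  interior_convexHull_nonempty_iff_affineSpan_eq_top.2 (T.basis i).tot

lemma uniqueDiffOn_simplex (i : Fin T.m) : UniqueDiffOn ℝ (T.simplex i) :=
  uniqueDiffOn_convex (T.convex_simplex i) (T.interior_simplex_nonempty i)

lemma closure_interior_simplex (i : Fin T.m) : closure (interior (T.simplex i)) = T.simplex i := by
  rw [(T.convex_simplex i).closure_interior_eq_closure_of_nonempty_interior
    (T.interior_simplex_nonempty i), (T.isClosed_simplex i).closure_eq]

lemma affinePiece_sub (W : T.vertexSet → ℝ) (i : Fin T.m) (x z : E n) :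
    T.affinePiece W i x - T.affinePiece W i z = inner ℝ (T.grad W i) (x - z) := by
  simp only [affinePiece, inner_sub_right]; ring

lemma affinePiece_eq_sum (W : T.vertexSet → ℝ) (i : Fin T.m) (x : E n) :
    T.affinePiece W i x = ∑ j, T.bary i j x * W (T.node i j) := by
  have h1 : ∀ j, W (T.node i j) =
      T.affinePiece W i x + inner ℝ (T.grad W i) (T.vertex i j - x) := fun j => by
    rw [← T.affinePiece_vertex W i j, ← T.affinePiece_sub]; ring
  have h2 : ∑ j, T.bary i j x * inner ℝ (T.grad W i) (T.vertex i j - x) = 0 := by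
    have : ∑ j, T.bary i j x • (T.vertex i j - x) = 0 := by
      simp only [smul_sub, Finset.sum_sub_distrib, sum_bary_smul, ← Finset.sum_smul, sum_bary,
        one_smul, sub_self]
    simp only [← inner_smul_right, ← inner_sum, this, inner_zero_right]
  simp_rw [fun j => congrArg (T.bary i j x * ·) (h1 j), mul_add, Finset.sum_add_distrib, h2,
    ← Finset.sum_mul, sum_bary]
  ring

lemma cpa_eq_sum (W : T.vertexSet → ℝ) (i : Fin T.m) {x : E n} (hx : x ∈ T.simplex i) :
    T.cpa W x = ∑ j, T.bary i j x * W (T.node i j) := by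
  rw [T.cpa_eq_affinePiece W i hx, affinePiece_eq_sum]

lemma cpa_vertex (W : T.vertexSet → ℝ) (i : Fin T.m) (j : Fin (n + 1)) :
    T.cpa W (T.vertex i j) = W (T.node i j) := by
  rw [T.cpa_eq_affinePiece W i (T.vertex_mem i j), affinePiece_vertex]

lemma abs_affinePiece_sub_le (W : T.vertexSet → ℝ) (i : Fin T.m) (x z : E n) :
    |T.affinePiece W i x - T.affinePiece W i z| ≤ ‖T.grad W i‖ * ‖x - z‖ := by
  rw [affinePiece_sub]; exact abs_real_inner_le_norm _ _

end Triangulation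

/-! ### Interpolation error of a `C²` function on a simplex -/

/-- Restrict `φ` to the segment from `x₀` to `x` and apply the mean value inequality twice.
Derivatives are taken within `s` because the points may lie on its boundary. `M` bounds the second
derivative along the whole displacement and so already contains the factor `‖x - x₀‖²`. -/
lemma abs_sub_sub_fderivWithin_le {F : Type*} [NormedAddCommGroup F] [NormedSpace ℝ F]
    {s : Set F} (hs : Convex ℝ s) (hu : UniqueDiffOn ℝ s) {φ : F → ℝ} (hφ : ContDiffOn ℝ 2 φ s)
    {x₀ x : F} (hx₀ : x₀ ∈ s) (hx : x ∈ s) {M : ℝ}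
    (hM : ∀ ξ ∈ s, |fderivWithin ℝ (fderivWithin ℝ φ s) s ξ (x - x₀) (x - x₀)| ≤ M) :
    |φ x - φ x₀ - fderivWithin ℝ φ s x₀ (x - x₀)| ≤ M / 2 := by
  set d := x - x₀ with hd
  let γ : ℝ → F := fun t => x₀ + t • d
  have hγ : ∀ t, HasDerivWithinAt γ d (Icc 0 1) t := fun t => by
    exact ((((hasDerivAt_id t).smul_const d).const_add x₀).congr_deriv
      (one_smul ℝ d)).hasDerivWithinAt
  have hm : MapsTo γ (Icc 0 1) s := fun t ht => by
    have := hs hx₀ hx (sub_nonneg.2 ht.2) ht.1 (by ring)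
    convert this using 1
    simp only [γ, hd]; module
  have h1 : ∀ t ∈ Icc (0 : ℝ) 1,
      HasDerivWithinAt (fun t => φ (γ t)) (fderivWithin ℝ φ s (γ t) d) (Icc 0 1) t := fun t ht =>
    ((hφ.differentiableOn (by norm_num) _ (hm ht)).hasFDerivWithinAt).comp_hasDerivWithinAt t
      (hγ t) hm
  have hd1 : DifferentiableOn ℝ (fderivWithin ℝ φ s) s :=
    (hφ.fderivWithin hu (m := 1) (by norm_num)).differentiableOn (by norm_num)
  have h2 : ∀ t ∈ Icc (0 : ℝ) 1, HasDerivWithinAt (fun t => fderivWithin ℝ φ s (γ t) d)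
      (fderivWithin ℝ (fderivWithin ℝ φ s) s (γ t) d d) (Icc 0 1) t := fun t ht =>
    (((hd1 _ (hm ht)).hasFDerivWithinAt).comp_hasDerivWithinAt t
      (hγ t) hm).clm_apply (hasDerivWithinAt_const _ _ d) |>.congr_deriv (by simp)
  have h3 : ∀ t ∈ Icc (0 : ℝ) 1,
      ‖fderivWithin ℝ φ s (γ t) d - fderivWithin ℝ φ s (γ 0) d‖ ≤ M * t := fun t ht => by
    simpa [abs_of_nonneg ht.1] using
      (convex_Icc (0 : ℝ) 1).norm_image_sub_le_of_norm_hasDerivWithin_le h2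
      (fun t ht => hM _ (hm ht)) (left_mem_Icc.2 zero_le_one) ht
  -- The first-order remainder starts at `0` and its derivative is at most `M t`, so it stays below
  -- `M t² / 2`.
  have h4 := image_norm_le_of_norm_deriv_right_le_deriv_boundary
    (f := fun t => φ (γ t) - φ (γ 0) - t * fderivWithin ℝ φ s (γ 0) d)
    (f' := fun t => fderivWithin ℝ φ s (γ t) d - fderivWithin ℝ φ s (γ 0) d)
    (a := 0) (b := 1) (B := fun t => M * t ^ 2 / 2) (B' := fun t => M * t)
    (fun t ht => (((h1 t ht).sub_const _).sub
        ((hasDerivAt_id t).hasDerivWithinAt.mul_const _)).continuousWithinAt)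
    (fun t ht => by
      have : HasDerivWithinAt (fun t => φ (γ t) - φ (γ 0) - t * fderivWithin ℝ φ s (γ 0) d)
          (fderivWithin ℝ φ s (γ t) d - 1 * fderivWithin ℝ φ s (γ 0) d) (Icc 0 1) t :=
        ((h1 t ⟨ht.1, ht.2.le⟩).sub_const (φ (γ 0))).sub
          ((hasDerivAt_id t).hasDerivWithinAt.mul_const (fderivWithin ℝ φ s (γ 0) d))
      rw [one_mul] at this
      refine this.mono_of_mem_nhdsWithin ?_
      exact mem_of_superset (Icc_mem_nhdsGE ht.2) (Icc_subset_Icc_left ht.1))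
    (by simp)
    (fun t => by
      have := ((hasDerivAt_pow 2 t).const_mul M).div_const 2
      exact this.congr_deriv (by norm_num; ring))
    (fun t ht => h3 t ⟨ht.1, ht.2.le⟩) (right_mem_Icc.2 zero_le_one)
  simpa [γ, hd] using h4

/-- The entrywise bound gives `β` times the squared `ℓ¹` norm, and Cauchy–Schwarz costs a factor
`n`. This is the `n` in `c_{i,j}`. -/
lemma abs_bilin_apply_le {n : ℕ} (B : E n →L[ℝ] E n →L[ℝ] ℝ) {β : ℝ}
    (hB : ∀ q r, |B (EuclideanSpace.single q 1) (EuclideanSpace.single r 1)| ≤ β) (d : E n) :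
    |B d d| ≤ n * β * ‖d‖ ^ 2 := by
  have hd : d = ∑ q, d q • EuclideanSpace.single q (1 : ℝ) := by
    simpa using ((EuclideanSpace.basisFun (Fin n) ℝ).sum_repr d).symm
  have h1 : B d d = ∑ q, ∑ r, d q * d r *
      B (EuclideanSpace.single q 1) (EuclideanSpace.single r 1) := by
    conv_lhs => rw [hd]
    simp only [map_sum, map_smul, sum_apply, smul_apply,
      smul_eq_mul, Finset.mul_sum, mul_assoc]
    rw [Finset.sum_comm]
    exact Finset.sum_congr rfl fun _ _ => Finset.sum_congr rfl fun _ _ => by ring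
  have h2 : |B d d| ≤ β * (∑ q, |d q|) ^ 2 := by
    rw [h1, sq, Finset.sum_mul_sum, Finset.mul_sum]
    refine (Finset.abs_sum_le_sum_abs _ _).trans (Finset.sum_le_sum fun q _ => ?_)
    rw [Finset.mul_sum]
    refine (Finset.abs_sum_le_sum_abs _ _).trans (Finset.sum_le_sum fun r _ => ?_)
    rw [abs_mul, abs_mul, mul_comm]
    exact mul_le_mul_of_nonneg_right (hB q r) (by positivity)
  have h3 : (∑ q, |d q|) ^ 2 ≤ n * ‖d‖ ^ 2 := by
    rw [EuclideanSpace.norm_sq_eq]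
    simpa using sq_sum_le_card_mul_sum_sq (s := Finset.univ) (f := fun q => |d q|)
  -- In dimension `0` no entry forces `β ≥ 0`, but both sides vanish.
  rcases isEmpty_or_nonempty (Fin n) with h | ⟨⟨q⟩⟩
  · simp [h1, Finset.univ_eq_empty]
    obtain rfl : n = 0 := by
      by_contra h0; exact h.false ⟨0, Nat.pos_of_ne_zero h0⟩
    simp
  · have hβ : 0 ≤ β := (abs_nonneg _).trans (hB q q)
    calc _ ≤ _ := h2
      _ ≤ β * (n * ‖d‖ ^ 2) := mul_le_mul_of_nonneg_left h3 hβ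
      _ = _ := by ring

namespace Triangulation

variable {n : ℕ} (T : Triangulation n)

/-- Expand at `x_{i,0}`, both at `x` and at every vertex. Interpolation reproduces affine functions,
so only the second-order remainders survive. The one at `x` produces the maximum term of `c_{i,j}`,
those at the vertices the other term. -/
lemma abs_sub_sum_bary_le {f : E n → E n} {i : Fin T.m} (hf : ContDiffOn ℝ 2 f (T.simplex i))
    {β : ℝ} {p : Fin n} (hβ : ∀ q r : Fin n, ∀ ξ ∈ T.simplex i, |T.secondPartial f i p q r ξ| ≤ β)
    {x : E n} (hx : x ∈ T.simplex i) :
    |f x p - ∑ j, T.bary i j x * f (T.vertex i j) p| ≤ β * ∑ j, T.bary i j x * T.c i j := by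
  set s := T.simplex i
  set x₀ := T.vertex i 0
  set φ : E n → ℝ := fun y => f y p with hφdef
  have hx₀ : x₀ ∈ s := T.vertex_mem i 0
  have hβ0 : 0 ≤ β := (abs_nonneg _).trans (hβ p p x hx)
  have hφ : ContDiffOn ℝ 2 φ s := (contDiffOn_euclidean.1 hf) p
  have taylor : ∀ z ∈ s, |φ z - φ x₀ - fderivWithin ℝ φ s x₀ (z - x₀)| ≤
      n * β * ‖z - x₀‖ ^ 2 / 2 := fun z hz =>
    abs_sub_sub_fderivWithin_le (T.convex_simplex i) (T.uniqueDiffOn_simplex i) hφ hx₀ hz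
      fun ξ hξ => abs_bilin_apply_le _ (fun q r => by
        have := hβ q r ξ hξ
        rw [secondPartial, iteratedFDerivWithin_two_apply _ (T.uniqueDiffOn_simplex i) hξ] at this
        simpa using this) _
  set α : Fin (n + 1) → ℝ := fun j => T.bary i j x with hα
  have hα0 : ∀ j, 0 ≤ α j := T.mem_simplex.1 hx
  have hα1 : ∑ j, α j = 1 := T.sum_bary i x
  set R := ⨆ k : Fin n, ‖T.vertex i k.succ - T.vertex i 0‖
  have hd : x - x₀ = ∑ j, α j • (T.vertex i j - x₀) := by
    simp only [smul_sub, Finset.sum_sub_distrib, ← Finset.sum_smul, hα1, one_smul]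
    rw [T.sum_bary_smul]
  have hlin : fderivWithin ℝ φ s x₀ (x - x₀) =
      ∑ j, α j * fderivWithin ℝ φ s x₀ (T.vertex i j - x₀) := by
    rw [hd, map_sum]; simp
  have hdn : ‖x - x₀‖ ≤ ∑ j, α j * ‖T.vertex i j - x₀‖ := by
    rw [hd]
    refine (norm_sum_le _ _).trans (Finset.sum_le_sum fun j _ => ?_)
    rw [norm_smul, Real.norm_of_nonneg (hα0 j)]
  have hR : ∀ j, ‖T.vertex i j - x₀‖ ≤ R := Fin.cases
    (by simpa [x₀] using Real.iSup_nonneg fun k => norm_nonneg _)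
    (fun k => le_ciSup (f := fun k : Fin n => ‖T.vertex i k.succ - T.vertex i 0‖)
      (finite_range _).bddAbove k)
  have hxR : ‖x - x₀‖ ≤ R := hdn.trans <| by
    calc _ ≤ ∑ j, α j * R := Finset.sum_le_sum fun j _ => mul_le_mul_of_nonneg_left (hR j) (hα0 j)
      _ = R := by rw [← Finset.sum_mul, hα1, one_mul]
  -- One factor is bounded by the convex combination and the other by `R`, which keeps the bound
  -- linear in the weights `α j`.
  have hsq : ‖x - x₀‖ ^ 2 ≤ ∑ j, α j * (‖T.vertex i j - x₀‖ * R) := by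
    calc ‖x - x₀‖ ^ 2 ≤ (∑ j, α j * ‖T.vertex i j - x₀‖) * R := by
          rw [sq]; exact mul_le_mul hdn hxR (norm_nonneg _) ((norm_nonneg _).trans hdn)
      _ = _ := by rw [Finset.sum_mul]; simp only [mul_assoc]
  have hid : φ x - ∑ j, α j * φ (T.vertex i j) =
      (φ x - φ x₀ - fderivWithin ℝ φ s x₀ (x - x₀)) - ∑ j, α j *
        (φ (T.vertex i j) - φ x₀ - fderivWithin ℝ φ s x₀ (T.vertex i j - x₀)) := by
    simp only [mul_sub, Finset.sum_sub_distrib, ← Finset.sum_mul, hα1]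
    rw [hlin]
    simp only [map_sub, mul_sub, Finset.sum_sub_distrib, ← Finset.sum_mul, hα1]
    ring
  calc |φ x - ∑ j, α j * φ (T.vertex i j)|
      ≤ n * β * ‖x - x₀‖ ^ 2 / 2 + ∑ j, α j * (n * β * ‖T.vertex i j - x₀‖ ^ 2 / 2) := by
        rw [hid]
        refine (abs_sub _ _).trans (add_le_add (taylor x hx) ?_)
        refine (Finset.abs_sum_le_sum_abs _ _).trans (Finset.sum_le_sum fun j _ => ?_)
        rw [abs_mul, abs_of_nonneg (hα0 j)]
        exact mul_le_mul_of_nonneg_left (taylor _ (T.vertex_mem i j)) (hα0 j)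
    _ ≤ n * β * (∑ j, α j * (‖T.vertex i j - x₀‖ * R)) / 2 +
        ∑ j, α j * (n * β * ‖T.vertex i j - x₀‖ ^ 2 / 2) := by gcongr
    _ = β * ∑ j, α j * T.c i j := by
        rw [Finset.mul_sum, Finset.mul_sum, Finset.sum_div, ← Finset.sum_add_distrib]
        refine Finset.sum_congr rfl fun j _ => ?_
        simp only [c, x₀, R]; ring

end Triangulation

/-! ### Lipschitz continuity of the interpolation across simplexes -/

namespace Triangulation

variable {n : ℕ} (T : Triangulation n)

open Classical in
/-- The vertices of `σ_k` that do not belong to `σ_i`. -/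
def freeVertices (i k : Fin T.m) : Finset (Fin (n + 1)) :=
  {j | T.vertex k j ∉ range (T.vertex i)}

lemma mem_freeVertices {i k : Fin T.m} {j : Fin (n + 1)} :
    j ∈ T.freeVertices i k ↔ T.vertex k j ∉ range (T.vertex i) := by simp [freeVertices]

/-- The total barycentric weight in `σ_k` of the vertices not belonging to `σ_i`. -/
def freeWeight (i k : Fin T.m) (x : E n) : ℝ := ∑ j ∈ T.freeVertices i k, T.bary k j x

lemma freeWeight_combo (i k : Fin T.m) {s t : ℝ} (hst : s + t = 1) (x z : E n) :
    T.freeWeight i k (s • x + t • z) = s * T.freeWeight i k x + t * T.freeWeight i k z := by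
  simp only [freeWeight, Finset.mul_sum, ← Finset.sum_add_distrib,
    Convex.combo_affine_apply hst, smul_eq_mul]

lemma freeWeight_nonneg (i : Fin T.m) {k : Fin T.m} {x : E n} (hx : x ∈ T.simplex k) :
    0 ≤ T.freeWeight i k x :=
  Finset.sum_nonneg fun j _ => T.mem_simplex.1 hx j

lemma freeWeight_le_one (i : Fin T.m) {k : Fin T.m} {x : E n} (hx : x ∈ T.simplex k) :
    T.freeWeight i k x ≤ 1 := by
  rw [← T.sum_bary k x]
  exact Finset.sum_le_univ_sum_of_nonneg fun j => T.mem_simplex.1 hx j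

lemma bary_vertex (i : Fin T.m) (j l : Fin (n + 1)) :
    T.bary i j (T.vertex i l) = if j = l then 1 else 0 := by
  classical
  exact (T.basis i).coord_apply j l

lemma freeWeight_vertex (i k : Fin T.m) (l : Fin (n + 1)) :
    T.freeWeight i k (T.vertex k l) = if l ∈ T.freeVertices i k then 1 else 0 := by
  simp only [freeWeight, bary_vertex]
  simp

lemma freeWeight_eq_zero {i k : Fin T.m} {x : E n} (hi : x ∈ T.simplex i) (hk : x ∈ T.simplex k) :
    T.freeWeight i k x = 0 := by
  refine le_antisymm ?_ (T.freeWeight_nonneg i hk)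
  have hx : x ∈ convexHull ℝ (range (T.vertex k) ∩ range (T.vertex i)) := by
    rw [← T.inter_face k i]; exact ⟨hk, hi⟩
  have hconv : Convex ℝ {z | T.freeWeight i k z ≤ 0} := by
    intro y hy z hz s t hs ht hst
    simp only [mem_ofPred_eq] at hy hz ⊢
    rw [freeWeight_combo _ _ _ hst]
    nlinarith
  refine convexHull_min ?_ hconv hx
  rintro _ ⟨⟨l, rfl⟩, hl⟩
  rw [mem_ofPred_eq, freeWeight_vertex, if_neg (by rwa [mem_freeVertices, not_not])]

/-- The polyhedral cone-like neighbourhood of `σ_i` cut out by those of its facets that contain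
the common face with `σ_k`. -/
def shadow (i k : Fin T.m) : Set (E n) := {x | ∀ j ∈ T.freeVertices k i, 0 ≤ T.bary i j x}

lemma isClosed_shadow (i k : Fin T.m) : IsClosed (T.shadow i k) := by
  simp only [shadow, ofPred_forall]
  exact isClosed_iInter fun j => isClosed_iInter fun _ =>
    isClosed_le continuous_const (T.continuous_bary i j)

/-- Move slightly from the centroid `p` of the common vertices towards `b`. Coordinates of `σ_i` at
common vertices are positive at `p` and stay nonnegative; the others are nonnegative at both ends.
The new point is thus in both simplexes, where the free weight vanishes. This weight is affine and
zero at `p`, so it is zero at `b`. -/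
lemma freeWeight_eq_zero_of_mem_shadow {i k : Fin T.m} (h : (T.simplex i ∩ T.simplex k).Nonempty)
    {b : E n} (hi : b ∈ T.shadow i k) (hk : b ∈ T.simplex k) : T.freeWeight i k b = 0 := by
  classical
  set G : Finset (Fin (n + 1)) := (T.freeVertices k i)ᶜ
  have hG : ∀ {j}, j ∈ G ↔ T.vertex i j ∈ range (T.vertex k) := fun {j} => by
    simp [G, mem_freeVertices]
  have hGne : G.Nonempty := by
    have : (convexHull ℝ (range (T.vertex i) ∩ range (T.vertex k))).Nonempty := by
      rw [← T.inter_face i k]; exact h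
    obtain ⟨_, ⟨j, rfl⟩, hj⟩ := convexHull_nonempty_iff.1 this
    exact ⟨j, hG.2 hj⟩
  have hN : (0 : ℝ) < G.card := by exact_mod_cast hGne.card_pos
  have hw : ∑ j ∈ G, ((G.card : ℝ)⁻¹) = 1 := by
    rw [Finset.sum_const, nsmul_eq_mul, mul_inv_cancel₀ hN.ne']
  set p := ∑ j ∈ G, (G.card : ℝ)⁻¹ • T.vertex i j with hp
  have hpi : p ∈ T.simplex i := (T.convex_simplex i).sum_mem (fun _ _ => by positivity) hw
    fun j _ => T.vertex_mem i j
  have hpk : p ∈ T.simplex k := (T.convex_simplex k).sum_mem (fun _ _ => by positivity) hw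
    fun j hj => by
      obtain ⟨l, hl⟩ := hG.1 hj
      rw [← hl]; exact T.vertex_mem k l
  have hpG : ∀ j ∈ G, T.bary i j p = (G.card : ℝ)⁻¹ := fun j hj => by
    rw [← (T.basis i).coord_apply_centroid hj, Finset.centroid_def,
      Finset.affineCombination_eq_linear_combination _ _ _
        (G.sum_centroidWeights_eq_one_of_nonempty ℝ hGne)]
    rfl
  obtain ⟨ε, hε0, hε1, hε⟩ : ∃ ε : ℝ, 0 < ε ∧ ε < 1 ∧
      ∀ j ∈ G, 0 ≤ (1 - ε) * (G.card : ℝ)⁻¹ + ε * T.bary i j b := by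
    have hev : ∀ j ∈ G, ∀ᶠ ε : ℝ in 𝓝[>] 0,
        0 < (1 - ε) * (G.card : ℝ)⁻¹ + ε * T.bary i j b := fun j _ => by
      have hc : ContinuousAt (fun ε : ℝ => (1 - ε) * (G.card : ℝ)⁻¹ + ε * T.bary i j b) 0 := by
        fun_prop
      exact nhdsWithin_le_nhds (hc.eventually (lt_mem_nhds (by simpa using hN)))
    have h1 : ∀ᶠ ε : ℝ in 𝓝[>] 0, ε ∈ Ioo (0 : ℝ) 1 := Ioo_mem_nhdsGT zero_lt_one
    obtain ⟨ε, h, h'⟩ := (h1.and ((Finset.eventually_all G).2 hev)).exists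
    exact ⟨ε, h.1, h.2, fun j hj => (h' j hj).le⟩
  have hst : (1 - ε) + ε = 1 := by ring
  have hqk : (1 - ε) • p + ε • b ∈ T.simplex k :=
    T.convex_simplex k hpk hk (by linarith) hε0.le hst
  have hqi : (1 - ε) • p + ε • b ∈ T.simplex i := by
    refine T.mem_simplex.2 fun j => ?_
    rw [Convex.combo_affine_apply hst, smul_eq_mul, smul_eq_mul]
    by_cases hj : j ∈ G
    · rw [hpG j hj]; exact hε j hj
    · exact add_nonneg (mul_nonneg (by linarith) (T.mem_simplex.1 hpi j))
        (mul_nonneg hε0.le (hi j (by simpa [G] using hj)))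
  have h0 := T.freeWeight_eq_zero hqi hqk
  rw [freeWeight_combo _ _ _ hst, T.freeWeight_eq_zero hpi hpk] at h0
  simpa [hε0.ne'] using h0

/-- Subtracting from both points the part `c` of `z` carried by the common vertices and rescaling by
`s⁻¹` puts `z` on the face of `σ_k` opposite the common face. The point coming from `y` may leave
`σ_i` but stays in the shadow. -/
lemma exists_freeWeight_eq_one {i k : Fin T.m} {y z : E n} (hy : y ∈ T.simplex i)
    (hz : z ∈ T.simplex k) (hs : 0 < T.freeWeight i k z) :
    ∃ b ∈ T.simplex k, ∃ b' ∈ T.shadow i k, T.freeWeight i k b = 1 ∧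
      z - y = T.freeWeight i k z • (b - b') := by
  classical
  set s := T.freeWeight i k z with hsdef
  set J := T.freeVertices i k with hJ
  have hw : ∑ j ∈ J, s⁻¹ * T.bary k j z = 1 := by
    rw [← Finset.mul_sum]; exact inv_mul_cancel₀ hs.ne'
  have hsplit : ∑ j ∈ Jᶜ, T.bary k j z = 1 - s := by
    rw [← T.sum_bary k z, ← Finset.sum_add_sum_compl J]
    simp [hsdef, freeWeight, hJ]
  set c := ∑ j ∈ Jᶜ, T.bary k j z • T.vertex k j with hc
  have hzc : z = (∑ j ∈ J, T.bary k j z • T.vertex k j) + c := by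
    rw [hc, Finset.sum_add_sum_compl]; exact (T.sum_bary_smul k z).symm
  have hb : s⁻¹ • (z - c) = ∑ j ∈ J, (s⁻¹ * T.bary k j z) • T.vertex k j := by
    rw [sub_eq_of_eq_add hzc, Finset.smul_sum]
    simp only [smul_smul]
  refine ⟨s⁻¹ • (z - c), ?_, s⁻¹ • (y - c), ?_, ?_, ?_⟩
  · rw [hb]
    exact (T.convex_simplex k).sum_mem
      (fun j _ => mul_nonneg (inv_nonneg.2 hs.le) (T.mem_simplex.1 hz j)) hw
      fun j _ => T.vertex_mem k j
  · intro j hj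
    set A := T.bary i j
    have hA : ∀ x, A.linear x = A x - A 0 := fun x => by
      have := congrFun A.decomp x
      simp only [Pi.add_apply] at this
      linarith
    have hAv : ∀ l ∈ Jᶜ, A (T.vertex k l) = 0 := fun l hl => by
      have hl' : T.vertex k l ∈ range (T.vertex i) := by
        simpa [hJ, mem_freeVertices] using hl
      obtain ⟨l', hl'⟩ := hl'
      have hne : j ≠ l' := by
        rintro rfl
        rw [mem_freeVertices] at hj
        exact hj ⟨l, hl'.symm⟩
      rw [← hl', show A = T.bary i j from rfl, bary_vertex, if_neg hne]
    -- The weights in `c` sum to `1 - s` and `A` vanishes at its vertices; hence `A` at the rescaled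
    -- point is just `s⁻¹ * A y`.
    have hAc : A.linear c = - (1 - s) * A 0 := by
      rw [hc, map_sum, ← hsplit, ← Finset.sum_neg_distrib, Finset.sum_mul]
      refine Finset.sum_congr rfl fun l hl => ?_
      rw [map_smul, hA, hAv l hl, smul_eq_mul]; ring
    have h1 : A (s⁻¹ • (y - c)) = s⁻¹ * A y := by
      have h2 := hA (s⁻¹ • (y - c))
      rw [map_smul, map_sub, hAc, hA y, smul_eq_mul] at h2
      have : s⁻¹ * s = 1 := inv_mul_cancel₀ hs.ne'
      linear_combination -h2 - A 0 * this
    rw [h1]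
    exact mul_nonneg (inv_nonneg.2 hs.le) (T.mem_simplex.1 hy j)
  · have h1 : ∀ j ∈ J, T.bary k j (s⁻¹ • (z - c)) = s⁻¹ * T.bary k j z := fun j hj => by
      rw [hb, ← Finset.affineCombination_eq_linear_combination J _ _ hw]
      exact (T.basis k).coord_apply_combination_of_mem hj hw
    rw [freeWeight, Finset.sum_congr rfl h1, hw]
  · rw [smul_sub, smul_smul, smul_smul, mul_inv_cancel₀ hs.ne', one_smul, one_smul]
    abel

/-- Two simplexes of the triangulation separate at least linearly away from their common face. By
rescaling, this reduces to the positive distance between the compact opposite face and the closed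
shadow, which are disjoint. If the simplexes do not meet, their distance serves, the free weight
being at most `1`. -/
lemma exists_freeWeight_le (i k : Fin T.m) :
    ∃ δ > 0, ∀ y ∈ T.simplex i, ∀ z ∈ T.simplex k, δ * T.freeWeight i k z ≤ ‖z - y‖ := by
  by_cases h : (T.simplex i ∩ T.simplex k).Nonempty
  · set K := {b | b ∈ T.simplex k ∧ T.freeWeight i k b = 1}
    have hK : IsCompact K := (T.isCompact_simplex k).inter_right <| by
      refine isClosed_eq ?_ continuous_const
      exact continuous_finsetSum _ fun j _ => T.continuous_bary k j
    have hdisj : Disjoint K (T.shadow i k) := disjoint_left.2 fun b hb hb' => by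
      have := T.freeWeight_eq_zero_of_mem_shadow h hb' hb.1
      rw [hb.2] at this
      exact one_ne_zero this
    obtain ⟨δ, hδ, hd⟩ := Metric.exists_pos_forall_lt_edist hK (T.isClosed_shadow i k) hdisj
    refine ⟨δ, hδ, fun y hy z hz => ?_⟩
    rcases (T.freeWeight_nonneg i hz).eq_or_lt with hs | hs
    · rw [← hs]; simp
    · obtain ⟨b, hb, b', hb', hb1, he⟩ := T.exists_freeWeight_eq_one hy hz hs
      have h1 := hd b ⟨hb, hb1⟩ b' hb'
      rw [edist_nndist, ENNReal.coe_lt_coe, ← NNReal.coe_lt_coe, coe_nndist, dist_eq_norm] at h1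
      rw [he, norm_smul, Real.norm_of_nonneg hs.le, mul_comm]
      exact mul_le_mul_of_nonneg_left h1.le hs.le
  · have hdisj : Disjoint (T.simplex k) (T.simplex i) :=
      disjoint_left.2 fun b hb hb' => h ⟨b, hb', hb⟩
    obtain ⟨δ, hδ, hd⟩ := Metric.exists_pos_forall_lt_edist (T.isCompact_simplex k)
      (T.isClosed_simplex i) hdisj
    refine ⟨δ, hδ, fun y hy z hz => ?_⟩
    have h1 := hd z hz y hy
    rw [edist_nndist, ENNReal.coe_lt_coe, ← NNReal.coe_lt_coe, coe_nndist, dist_eq_norm] at h1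
    exact (mul_le_of_le_one_right δ.coe_nonneg (T.freeWeight_le_one i hz)).trans h1.le

/-- The segment from `y` to `z` may leave the triangulation, so gradient bounds alone do not
suffice. The two affine pieces agree at common vertices, so at `z` they differ by at most a multiple
of the free weight, which `‖z - y‖` controls. -/
lemma exists_abs_cpa_sub_le (W : T.vertexSet → ℝ) (i k : Fin T.m) :
    ∃ C, 0 ≤ C ∧ ∀ y ∈ T.simplex i, ∀ z ∈ T.simplex k,
      |T.cpa W z - T.cpa W y| ≤ C * ‖z - y‖ := by
  obtain ⟨δ, hδ, hd⟩ := T.exists_freeWeight_le i k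
  set e : Fin (n + 1) → ℝ := fun j => W (T.node k j) - T.affinePiece W i (T.vertex k j) with he
  set M := ∑ j, |e j|
  have hM : ∀ j, |e j| ≤ M := fun j =>
    Finset.single_le_sum (f := fun j => |e j|) (fun j _ => abs_nonneg _) (Finset.mem_univ j)
  have hM0 : 0 ≤ M := Finset.sum_nonneg fun j _ => abs_nonneg _
  refine ⟨M / δ + ‖T.grad W i‖, by positivity, fun y hy z hz => ?_⟩
  have h0 : ∀ j, j ∉ T.freeVertices i k → e j = 0 := fun j hj => by
    rw [mem_freeVertices, not_not] at hj
    obtain ⟨l, hl⟩ := hj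
    have hn : T.node k j = T.node i l := Subtype.ext hl.symm
    simp only [he]
    rw [hn, ← hl, affinePiece_vertex, sub_self]
  have h1 : T.affinePiece W k z - T.affinePiece W i z =
      ∑ j ∈ T.freeVertices i k, T.bary k j z * e j := by
    rw [Finset.sum_subset (Finset.subset_univ _) fun j _ hj => by rw [h0 j hj, mul_zero]]
    simp only [he, mul_sub, Finset.sum_sub_distrib]
    rw [← affinePiece_eq_sum]
    congr 1
    have h2 : ∀ j, T.affinePiece W i (T.vertex k j) =
        T.affinePiece W i z + inner ℝ (T.grad W i) (T.vertex k j - z) := fun j => by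
      rw [← T.affinePiece_sub]; ring
    have h3 : ∑ j, T.bary k j z * inner ℝ (T.grad W i) (T.vertex k j - z) = 0 := by
      have : ∑ j, T.bary k j z • (T.vertex k j - z) = 0 := by
        simp only [smul_sub, Finset.sum_sub_distrib, sum_bary_smul, ← Finset.sum_smul, sum_bary,
          one_smul, sub_self]
      simp only [← inner_smul_right, ← inner_sum, this, inner_zero_right]
    simp_rw [h2, mul_add, Finset.sum_add_distrib, h3, ← Finset.sum_mul, sum_bary]
    ring
  have h2 : |T.affinePiece W k z - T.affinePiece W i z| ≤ M / δ * ‖z - y‖ := by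
    calc _ ≤ ∑ j ∈ T.freeVertices i k, T.bary k j z * M := by
          rw [h1]
          refine (Finset.abs_sum_le_sum_abs _ _).trans (Finset.sum_le_sum fun j _ => ?_)
          rw [abs_mul, abs_of_nonneg (T.mem_simplex.1 hz j)]
          exact mul_le_mul_of_nonneg_left (hM j) (T.mem_simplex.1 hz j)
      _ = M / δ * (δ * T.freeWeight i k z) := by
          rw [← Finset.sum_mul, freeWeight]; field_simp
      _ ≤ _ := mul_le_mul_of_nonneg_left (hd y hy z hz) (by positivity)
  rw [T.cpa_eq_affinePiece W k hz, T.cpa_eq_affinePiece W i hy]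
  calc _ = |(T.affinePiece W k z - T.affinePiece W i z) +
        (T.affinePiece W i z - T.affinePiece W i y)| := by congr 1; ring
    _ ≤ M / δ * ‖z - y‖ + ‖T.grad W i‖ * ‖z - y‖ :=
      (abs_add_le _ _).trans (add_le_add h2 (T.abs_affinePiece_sub_le W i z y))
    _ = _ := by ring

/-- A continuous piecewise affine function is Lipschitz on the whole triangulation. -/
lemma exists_lipschitzOnWith_cpa (W : T.vertexSet → ℝ) :
    ∃ K, LipschitzOnWith K (T.cpa W) T.carrier := by
  choose C hC0 hC using T.exists_abs_cpa_sub_le W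
  refine ⟨Real.toNNReal (∑ i, ∑ k, C i k), LipschitzOnWith.of_dist_le_mul fun z hz y hy => ?_⟩
  obtain ⟨k, hk⟩ := mem_iUnion.1 hz
  obtain ⟨i, hi⟩ := mem_iUnion.1 hy
  rw [Real.coe_toNNReal _ (Finset.sum_nonneg fun i _ => Finset.sum_nonneg fun k _ => hC0 i k),
    Real.dist_eq, dist_eq_norm]
  refine (hC i k y hi z hk).trans (mul_le_mul_of_nonneg_right ?_ (norm_nonneg _))
  calc C i k ≤ ∑ k, C i k :=
        Finset.single_le_sum (f := fun k => C i k) (fun k _ => hC0 i k) (Finset.mem_univ k)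
    _ ≤ _ := Finset.single_le_sum (f := fun i => ∑ k, C i k)
        (fun i _ => Finset.sum_nonneg fun k _ => hC0 i k) (Finset.mem_univ i)

lemma continuousOn_cpa (W : T.vertexSet → ℝ) : ContinuousOn (T.cpa W) T.carrier :=
  (T.exists_lipschitzOnWith_cpa W).choose_spec.continuousOn

end Triangulation

/-! ### The star of the origin and lower bounds from vertex values -/

namespace Triangulation

variable {n : ℕ} (T : Triangulation n)

lemma eq_zero_of_vertex_eq_zero {i : Fin T.m} {j : Fin (n + 1)} (h : T.vertex i j = 0) :
    j = 0 := by
  have h0 : T.vertex i 0 = 0 := T.origin_vertex i (h ▸ T.vertex_mem i j)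
  exact (T.affineIndependent i).injective (h.trans h0.symm)

lemma finite_vertexSet : T.vertexSet.Finite := by
  refine (finite_range fun q : Fin T.m × Fin (n + 1) => T.vertex q.1 q.2).subset ?_
  rintro x ⟨i, j, h⟩
  exact ⟨(i, j), h⟩

lemma isClosed_union (I : Set (Fin T.m)) : IsClosed (T.union I) :=
  I.toFinite.isClosed_biUnion fun i _ => T.isClosed_simplex i

lemma union_subset_carrier (I : Set (Fin T.m)) : T.union I ⊆ T.carrier :=
  iUnion₂_subset fun i _ => T.simplex_subset_carrier i

lemma mem_union {I : Set (Fin T.m)} {x : E n} : x ∈ T.union I ↔ ∃ i ∈ I, x ∈ T.simplex i := by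
  simp [union]

lemma zero_mem_interior_carrier : (0 : E n) ∈ interior T.carrier := T.isRegion.zero_mem

lemma exists_zero_mem_simplex : ∃ i, (0 : E n) ∈ T.simplex i :=
  mem_iUnion.1 (interior_subset T.zero_mem_interior_carrier)

/-- Points of the triangulation close to `x` lie in simplexes that contain `x`. -/
lemma eventually_mem_simplex (x : E n) : ∀ᶠ z in 𝓝 x, ∀ i, z ∈ T.simplex i → x ∈ T.simplex i := by
  refine eventually_all.2 fun i => ?_
  by_cases hx : x ∈ T.simplex i
  · exact Eventually.of_forall fun _ _ => hx
  · filter_upwards [(T.isClosed_simplex i).isOpen_compl.mem_nhds hx] with z hz h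
    exact absurd h hz

/-- The simplexes containing the origin form a region. -/
lemma isRegion_star : IsRegion (T.union {i | (0 : E n) ∈ T.simplex i}) := by
  set S := T.union {i | (0 : E n) ∈ T.simplex i} with hS
  have h0 : (0 : E n) ∈ interior S := by
    rw [mem_interior_iff_mem_nhds]
    filter_upwards [mem_interior_iff_mem_nhds.1 T.zero_mem_interior_carrier,
      T.eventually_mem_simplex 0] with z hz h
    obtain ⟨i, hi⟩ := mem_iUnion.1 hz
    exact T.mem_union.2 ⟨i, h i hi, hi⟩
  have hstar : ∀ t ∈ Ioc (0 : ℝ) 1, ∀ x ∈ S, t • x ∈ S := by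
    intro t ht x hx
    obtain ⟨i, hi, hxi⟩ := T.mem_union.1 hx
    exact T.mem_union.2 ⟨i, hi, (T.convex_simplex i).smul_mem_of_zero_mem hi hxi ⟨ht.1.le, ht.2⟩⟩
  refine ⟨(toFinite _).isCompact_biUnion fun i _ => T.isCompact_simplex i, h0, ?_, ?_⟩
  -- Scaling by `t > 0` maps the interior to an open subset of `S`, so the interior is star-shaped
  -- and hence connected.
  · have : StarConvex ℝ 0 (interior S) := by
      refine starConvex_zero_iff.2 fun x hx t ht0 ht1 => ?_
      rcases ht0.eq_or_lt with rfl | ht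
      · simpa using h0
      · refine interior_maximal ?_ (isOpen_interior.smul₀ ht.ne') (smul_mem_smul_set hx)
        rintro _ ⟨z, hz, rfl⟩
        exact hstar t ⟨ht, ht1⟩ z (interior_subset hz)
    exact (this.isPathConnected h0).isConnected
  · refine Subset.antisymm (closure_minimal interior_subset (T.isClosed_union _)) fun x hx => ?_
    obtain ⟨i, hi, hxi⟩ := T.mem_union.1 hx
    rw [← T.closure_interior_simplex i] at hxi
    exact closure_mono (interior_mono (subset_biUnion_of_mem (u := T.simplex) hi)) hxi

/-- A convex positively homogeneous lower bound at the vertices holds on the triangulation. -/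
lemma mul_norm_rpow_le_cpa {W : T.vertexSet → ℝ} {a b : ℝ} (ha : 1 ≤ a) (hb : 0 ≤ b)
    (h : ∀ v : T.vertexSet, b * ‖(v : E n)‖ ^ a ≤ W v) {x : E n} (hx : x ∈ T.carrier) :
    b * ‖x‖ ^ a ≤ T.cpa W x := by
  obtain ⟨i, hi⟩ := mem_iUnion.1 hx
  have h0 := T.mem_simplex.1 hi
  rw [T.cpa_eq_sum W i hi]
  have h1 : ‖x‖ ≤ ∑ j, T.bary i j x * ‖T.vertex i j‖ := by
    conv_lhs => rw [← T.sum_bary_smul i x]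
    refine (norm_sum_le _ _).trans_eq (Finset.sum_congr rfl fun j _ => ?_)
    rw [norm_smul, Real.norm_of_nonneg (h0 j)]
  calc b * ‖x‖ ^ a ≤ b * (∑ j, T.bary i j x * ‖T.vertex i j‖) ^ a := by gcongr
    _ ≤ b * ∑ j, T.bary i j x * ‖T.vertex i j‖ ^ a := by
      gcongr
      exact Real.rpow_arith_mean_le_arith_mean_rpow _ _ _ (fun j _ => h0 j) (T.sum_bary i x)
        (fun j _ => norm_nonneg _) ha
    _ = ∑ j, T.bary i j x * (b * ‖T.vertex i j‖ ^ a) := by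
      rw [Finset.mul_sum]; exact Finset.sum_congr rfl fun j _ => by ring
    _ ≤ _ := Finset.sum_le_sum fun j _ => mul_le_mul_of_nonneg_left (h (T.node i j)) (h0 j)

/-- Provides a lower bound with exponent `1` whatever the exponent of the program. For an exponent
below `1` the power of the norm is not convex, and the vertex bound need not extend to the
simplexes. -/
lemma exists_mul_norm_le {W : T.vertexSet → ℝ} (hz : ∀ v : T.vertexSet, (v : E n) = 0 → W v = 0)
    (hp : ∀ v : T.vertexSet, (v : E n) ≠ 0 → 0 < W v) :
    ∃ c > 0, ∀ v : T.vertexSet, c * ‖(v : E n)‖ ≤ W v := by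
  have := T.finite_vertexSet.fintype
  have hW : ∀ v, 0 ≤ W v := fun v => by
    by_cases h : (v : E n) = 0
    · exact (hz v h).ge
    · exact (hp v h).le
  have hq : ∀ v : T.vertexSet, 0 ≤ ‖(v : E n)‖ / W v := fun v => div_nonneg (norm_nonneg _) (hW v)
  set M := 1 + ∑ v : T.vertexSet, ‖(v : E n)‖ / W v
  have hM : 0 < M := by have := Finset.sum_nonneg fun v (_ : v ∈ Finset.univ) => hq v; positivity
  refine ⟨M⁻¹, inv_pos.2 hM, fun v => ?_⟩
  by_cases h : (v : E n) = 0
  · simp [h, hz v h]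
  · have h1 : ‖(v : E n)‖ / W v ≤ M :=
      (Finset.single_le_sum (fun v _ => hq v) (Finset.mem_univ v)).trans (by simp [M])
    rw [inv_mul_le_iff₀ hM]
    exact (div_le_iff₀ (hp v h)).1 h1

end Triangulation

/-! ### From the constraints to decay on the good simplexes -/

namespace Decision

variable {n m : ℕ} {Λ : Type*} {T : Triangulation n} {g : E n → E m → E n} {U : Set (E m)}
  {u : Λ → E n → E m} {β : Λ → Fin T.m → ℝ} {y : Decision T Λ}

lemma Feasible.V_pos (hy : y.Feasible g U u β) {v : T.vertexSet} (hv : (v : E n) ≠ 0) :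
    0 < y.V v :=
  (mul_pos hy.b₁_pos (Real.rpow_pos_of_pos (norm_pos_iff.2 hv) _)).trans_le (hy.lower v hv)

lemma Feasible.lower_all (hy : y.Feasible g U u β) (v : T.vertexSet) :
    y.b₁ * ‖(v : E n)‖ ^ y.a ≤ y.V v := by
  by_cases h : (v : E n) = 0
  · rw [hy.V_zero v h, h, norm_zero, Real.zero_rpow hy.a_pos.ne', mul_zero]
  · exact hy.lower v h

lemma Feasible.cpa_zero (hy : y.Feasible g U u β) : T.cpa y.V 0 = 0 := by
  obtain ⟨i, hi⟩ := T.exists_zero_mem_simplex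
  have h0 : T.vertex i 0 = 0 := T.origin_vertex i hi
  have := T.cpa_vertex y.V i 0
  rw [h0] at this
  rw [this]
  exact hy.V_zero _ h0

lemma closedLoop_zero (hg : g 0 0 = 0) (hu : ControllerClass T g U u) (lam : Λ) :
    closedLoop g u lam 0 = 0 := by
  simp only [closedLoop, hu.zero, hg]

/-- The orbital derivative of `V` on `σ_i` is bounded by the interpolation of the `D⁺_{i,j} V`. -/
lemma inner_grad_le_sum_dPlus (hu : ControllerClass T g U u) (hβ : IsHessianBound T g U u β)
    (hy : y.Feasible g U u β) (i : Fin T.m) {x : E n} (hx : x ∈ T.simplex i) :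
    inner ℝ (closedLoop g u y.lam x) (T.grad y.V i) ≤ ∑ j, T.bary i j x * y.dPlus g u β i j := by
  set f := closedLoop g u y.lam
  set G := T.grad y.V i
  have herr : ∀ p, |f x p - ∑ j, T.bary i j x * f (T.vertex i j) p| ≤
      β y.lam i * ∑ j, T.bary i j x * T.c i j := fun p =>
    T.abs_sub_sum_bary_le ((hu.piecewiseC2_closedLoop y.lam).2 i)
      (fun q r ξ hξ => hβ y.lam hy.input_mem i p q r ξ hξ) hx
  have hinner : ∀ z : E n, inner ℝ z G = ∑ p, z p * G p := fun z => by
    simp [PiLp.inner_apply, mul_comm]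
  have h1 : inner ℝ (f x) G = (∑ j, T.bary i j x * inner ℝ (f (T.vertex i j)) G) +
      ∑ p, (f x p - ∑ j, T.bary i j x * f (T.vertex i j) p) * G p := by
    simp only [hinner, sub_mul, Finset.sum_sub_distrib, Finset.mul_sum, Finset.sum_mul, mul_assoc]
    rw [Finset.sum_comm (s := Finset.univ (α := Fin (n + 1)))]
    ring
  -- The interpolation error of `f` is paired with the gradient, which `l` dominates componentwise;
  -- this is the correction term in `D⁺_{i,j} V`.
  have h2 : ∑ p, (f x p - ∑ j, T.bary i j x * f (T.vertex i j) p) * G p ≤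
      ∑ p, (β y.lam i * ∑ j, T.bary i j x * T.c i j) * y.l i p :=
    Finset.sum_le_sum fun p _ => (le_abs_self _).trans <| by
      rw [abs_mul]
      exact mul_le_mul (herr p) (hy.grad_le i p) (abs_nonneg _) ((abs_nonneg _).trans (herr p))
  rw [h1]
  refine (add_le_add_right h2 _).trans_eq ?_
  simp only [dPlus, mul_add, Finset.sum_add_distrib]
  congr 1
  rw [← Finset.mul_sum, mul_comm (β y.lam i), mul_assoc, Finset.sum_mul]
  exact Finset.sum_congr rfl fun j _ => by ring

/-- `V` decays at the rate `b` along the vector field on the good simplexes. -/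
lemma inner_grad_le (hg : g 0 0 = 0) (hu : ControllerClass T g U u)
    (hβ : IsHessianBound T g U u β) (hy : y.Feasible g U u β) {b : ℝ}
    (hb : b ∈ lowerBounds (y.decayRates g u β)) {i : Fin T.m} (hi : i ∈ y.goodSimplexes g u β)
    {x : E n} (hx : x ∈ T.simplex i) :
    inner ℝ (T.grad y.V i) (closedLoop g u y.lam x) ≤ -b * T.cpa y.V x := by
  rw [real_inner_comm, T.cpa_eq_sum y.V i hx, Finset.mul_sum]
  refine (inner_grad_le_sum_dPlus hu hβ hy i hx).trans (Finset.sum_le_sum fun j _ => ?_)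
  have h : y.dPlus g u β i j ≤ -b * y.V (T.node i j) := by
    -- The origin contributes no decay rate, but it can only be vertex number `0`, where `c`
    -- vanishes, and `f` and `V` vanish there too.
    by_cases h0 : T.vertex i j = 0
    · rw [hy.V_zero (T.node i j) h0, dPlus, h0, closedLoop_zero hg hu, T.eq_zero_of_vertex_eq_zero h0]
      simp [Triangulation.c]
    · have h1 := hb ⟨i, hi, j, h0, rfl⟩
      rw [le_div_iff₀ (hy.V_pos (v := T.node i j) h0)] at h1
      linarith
  calc _ ≤ T.bary i j x * (-b * y.V (T.node i j)) :=
        mul_le_mul_of_nonneg_left h (T.mem_simplex.1 hx j)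
    _ = _ := by ring

lemma exists_isLeast_decayRates (hn : 1 ≤ n) (hy : y.Feasible g U u β)
    (hI : ∀ i, (0 : E n) ∈ T.simplex i → i ∈ y.goodSimplexes g u β) :
    ∃ b, IsLeast (y.decayRates g u β) b ∧ 0 < b := by
  have hfin : (y.decayRates g u β).Finite := by
    refine (finite_range fun q : Fin T.m × Fin (n + 1) =>
      -y.dPlus g u β q.1 q.2 / y.V (T.node q.1 q.2)).subset ?_
    rintro s ⟨i, _, j, _, rfl⟩
    exact ⟨(i, j), rfl⟩
  have hne : (y.decayRates g u β).Nonempty := by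
    obtain ⟨i, hi⟩ := T.exists_zero_mem_simplex
    -- Only vertex number `0` can be the origin, and the last vertex is a different one because `n ≥
    -- 1`.
    refine ⟨_, i, hI i hi, Fin.last n, fun h => ?_, rfl⟩
    have := congrArg Fin.val (T.eq_zero_of_vertex_eq_zero h)
    simp at this
    omega
  obtain ⟨b, hb, hmin⟩ := hfin.exists_minimal hne
  refine ⟨b, ⟨hb, fun s hs => ?_⟩, ?_⟩
  · rcases le_total b s with h | h
    · exact h
    · exact hmin hs h
  · obtain ⟨i, hi, j, hj, rfl⟩ := hb
    exact div_pos (neg_pos.2 (hi j hj)) (hy.V_pos (v := T.node i j) hj)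

end Decision

/-! ### Global forward existence for Lipschitz fields -/

/-- An autonomous differential equation with globally Lipschitz right-hand side has solutions
for all future time. -/
lemma LipschitzWith.exists_hasDerivWithinAt_Ici {F : Type*} [NormedAddCommGroup F]
    [NormedSpace ℝ F] [CompleteSpace F] {f : F → F} {K : NNReal} (hf : LipschitzWith K f)
    (t₀ : ℝ) (x₀ : F) :
    ∃ x : ℝ → F, x t₀ = x₀ ∧ ∀ t ∈ Ici t₀, HasDerivWithinAt x (f (x t)) (Ici t₀) t := by
  -- On the ball of radius `‖f p‖` around `p` the field is at most `(1 + K) ‖f p‖`, so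
  -- Picard–Lindelöf gives a time step independent of `p`, and steps of this length can be
  -- concatenated.
  set τ : ℝ := 1 / (1 + K) with hτ
  have hτ0 : 0 < τ := by positivity
  have hloc : ∀ p : F, ∃ φ : ℝ → F, φ 0 = p ∧
      ∀ t ∈ Icc 0 τ, HasDerivWithinAt φ (f (φ t)) (Icc 0 τ) t := fun p => by
    have hpl : IsPicardLindelof (fun _ => f) (tmin := 0) (tmax := τ) ⟨0, left_mem_Icc.2 hτ0.le⟩ p
        ‖f p‖₊ 0 (‖f p‖₊ + K * ‖f p‖₊) K :=
      { lipschitzOnWith := fun _ _ => hf.lipschitzOnWith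
        continuousOn := fun _ _ => continuousOn_const
        norm_le := fun _ _ x hx => by
          have h1 := hf.dist_le_mul x p
          rw [dist_eq_norm] at h1
          have h2 : dist x p ≤ ‖f p‖ := by simpa using hx
          calc ‖f x‖ = ‖f p + (f x - f p)‖ := by congr 1; abel
            _ ≤ ‖f p‖ + ‖f x - f p‖ := norm_add_le _ _
            _ ≤ ‖f p‖ + K * ‖f p‖ := by
              gcongr; exact h1.trans (mul_le_mul_of_nonneg_left h2 K.coe_nonneg)
            _ = _ := by simp
        mul_max_le := by
          simp only [sub_zero, sub_self, NNReal.coe_add, NNReal.coe_mul, coe_nnnorm,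
            NNReal.coe_zero, max_eq_left hτ0.le]
          rw [hτ]
          refine le_of_eq ?_
          field_simp }
    exact hpl.exists_eq_forall_mem_Icc_hasDerivWithinAt₀
  choose φ hφ0 hφ using hloc
  let P : ℕ → F := fun k => Nat.rec x₀ (fun _ p => φ p τ) k
  have hP : ∀ k, P (k + 1) = φ (P k) τ := fun _ => rfl
  let x : ℝ → F := fun t => φ (P ⌊(t - t₀) / τ⌋₊) (t - t₀ - ⌊(t - t₀) / τ⌋₊ * τ)
  have hx : ∀ (k : ℕ), ∀ t ∈ Icc (t₀ + k * τ) (t₀ + (k + 1) * τ),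
      x t = φ (P k) (t - t₀ - k * τ) := by
    intro k t ht
    -- At the right end of a piece the floor has already jumped to `k + 1`; the two formulas agree
    -- since the next piece starts at `P (k + 1)`.
    rcases ht.2.eq_or_lt with h | h
    · have h1 : (t - t₀) / τ = ((k + 1 : ℕ) : ℝ) := by
        rw [h]; push_cast; field_simp; ring
      simp only [x, h1, Nat.floor_natCast]
      rw [hP, h]
      push_cast
      rw [show t₀ + (k + 1) * τ - t₀ - (k + 1) * τ = 0 by ring,
        show t₀ + (k + 1) * τ - t₀ - k * τ = τ by ring, hφ0]
    · have h1 : ⌊(t - t₀) / τ⌋₊ = k := by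
        rw [Nat.floor_eq_iff (div_nonneg (by nlinarith [ht.1, (Nat.cast_nonneg k : (0 : ℝ) ≤ k)])
          hτ0.le), le_div_iff₀ hτ0, div_lt_iff₀ hτ0]
        exact ⟨by linarith [ht.1], by linarith⟩
      simp only [x, h1]
  have hpiece : ∀ (k : ℕ), ∀ t ∈ Icc (t₀ + k * τ) (t₀ + (k + 1) * τ),
      HasDerivWithinAt x (f (x t)) (Icc (t₀ + k * τ) (t₀ + (k + 1) * τ)) t := by
    intro k t ht
    have hm : MapsTo (fun t => t - t₀ - k * τ) (Icc (t₀ + k * τ) (t₀ + (k + 1) * τ)) (Icc 0 τ) :=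
      fun s hs => ⟨by linarith [hs.1], by linarith [hs.2]⟩
    have h1 := (hφ (P k) _ (hm ht)).scomp t
      ((((hasDerivAt_id t).sub_const t₀).sub_const (k * τ)).hasDerivWithinAt) hm
    rw [one_smul, ← hx k t ht] at h1
    exact h1.congr (fun s hs => hx k s hs) (hx k t ht)
  refine ⟨x, ?_, fun t ht => ?_⟩
  · rw [hx 0 t₀ ⟨by simp, by simpa using hτ0.le⟩]
    simp only [Nat.cast_zero, zero_mul, sub_self]
    exact hφ0 x₀
  · have h0 : 0 ≤ (t - t₀) / τ := div_nonneg (sub_nonneg.2 ht) hτ0.le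
    have hright : HasDerivWithinAt x (f (x t)) (Ici t) t := by
      set k := ⌊(t - t₀) / τ⌋₊
      have h1 : t₀ + k * τ ≤ t := by
        have := (le_div_iff₀ hτ0).1 (Nat.floor_le h0)
        linarith
      have h2 : t < t₀ + (k + 1) * τ := by
        have := (div_lt_iff₀ hτ0).1 (Nat.lt_floor_add_one ((t - t₀) / τ))
        linarith
      exact (hpiece k t ⟨h1, h2.le⟩).mono_of_mem_nhdsWithin
        (mem_of_superset (Icc_mem_nhdsGE h2) (Icc_subset_Icc_left h1))
    rcases (show t₀ ≤ t from ht).eq_or_lt with rfl | hlt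
    · exact hright
    have hleft : HasDerivWithinAt x (f (x t)) (Iic t) t := by
      -- The ceiling selects the piece that reaches `t` from the left, also when `t` is a gluing
      -- time.
      obtain ⟨k, hk⟩ : ∃ k, ⌈(t - t₀) / τ⌉₊ = k + 1 :=
        Nat.exists_eq_succ_of_ne_zero (Nat.ceil_pos.2 (div_pos (sub_pos.2 hlt) hτ0)).ne'
      have h1 : t₀ + k * τ < t := by
        have := Nat.ceil_lt_add_one h0
        rw [hk] at this
        push_cast at this
        have := (lt_div_iff₀ hτ0).1 (by linarith : (k : ℝ) < (t - t₀) / τ)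
        linarith
      have h2 : t ≤ t₀ + (k + 1) * τ := by
        have := Nat.le_ceil ((t - t₀) / τ)
        rw [hk, div_le_iff₀ hτ0] at this
        push_cast at this
        linarith
      exact (hpiece k t ⟨h1.le, h2⟩).mono_of_mem_nhdsWithin
        (mem_of_superset (Icc_mem_nhdsLE h1) (Icc_subset_Icc_right h2))
    have := hleft.union hright
    rw [Iic_union_Ici] at this
    exact this.mono (subset_univ _)

/-! ### Decay along curves, invariance and stability -/

namespace Triangulation

variable {n : ℕ} {T : Triangulation n} {f : E n → E n} {W : T.vertexSet → ℝ} {I : Set (Fin T.m)}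
  {b : ℝ}

/-- The interpolation of `W` decays at the rate `b` along `f` on the simplexes with index
in `I`. -/
def DecaysOn (T : Triangulation n) (f : E n → E n) (W : T.vertexSet → ℝ) (I : Set (Fin T.m))
    (b : ℝ) : Prop :=
  ∀ i ∈ I, ∀ x ∈ T.simplex i, inner ℝ (T.grad W i) (f x) ≤ -b * T.cpa W x

/-- Just after `t` the curve is in good simplexes that contain `γ t`. On each of them the quotient
is the inner product of a constant gradient with the slope of `γ`, and its limit is below `r`.
Finiteness makes this uniform, however the curve switches simplexes. The lemma serves both straight
lines (the Dini derivative) and solutions. -/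
lemma DecaysOn.eventually_slope_lt (h : T.DecaysOn f W I b) {γ : ℝ → E n} {t r : ℝ}
    (hγ : HasDerivWithinAt γ (f (γ t)) (Ioi t) t) (hmem : ∀ᶠ s in 𝓝[>] t, γ s ∈ T.union I)
    (hr : -b * T.cpa W (γ t) < r) :
    ∀ᶠ s in 𝓝[>] t, (s - t)⁻¹ * (T.cpa W (γ s) - T.cpa W (γ t)) < r := by
  have h1 : ∀ᶠ s in 𝓝[>] t, ∀ i ∈ I, γ t ∈ T.simplex i →
      inner ℝ (T.grad W i) ((s - t)⁻¹ • (γ s - γ t)) < r := by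
    refine eventually_all.2 fun i => ?_
    by_cases hi : i ∈ I ∧ γ t ∈ T.simplex i
    · have hlim := (hasDerivWithinAt_iff_tendsto_slope' (by simp)).1 hγ
      have := (tendsto_const_nhds (x := T.grad W i)).inner (𝕜 := ℝ) hlim
      filter_upwards [this.eventually (gt_mem_nhds ((h i hi.1 _ hi.2).trans_lt hr))] with s hs _ _
      simpa only [slope_def_module] using hs
    · exact Eventually.of_forall fun s h1 h2 => absurd ⟨h1, h2⟩ hi
  have h2 : ∀ᶠ s in 𝓝[>] t, ∀ i, γ s ∈ T.simplex i → γ t ∈ T.simplex i :=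
    hγ.continuousWithinAt.eventually (T.eventually_mem_simplex (γ t))
  filter_upwards [h1, h2, hmem] with s hs1 hs2 hs3
  obtain ⟨i, hi, hsi⟩ := T.mem_union.1 hs3
  have := hs1 i hi (hs2 i hsi)
  rwa [inner_smul_right, ← affinePiece_sub, ← T.cpa_eq_affinePiece W i hsi,
    ← T.cpa_eq_affinePiece W i (hs2 i hsi)] at this

lemma DecaysOn.diniDeriv_le (h : T.DecaysOn f W I b) {x : E n}
    (hx : x ∈ interior (T.union I)) :
    diniDeriv f (T.cpa W) x ≤ ((-b * T.cpa W x : ℝ) : EReal) := by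
  refine EReal.le_of_forall_lt_iff_le.1 fun r hr => ?_
  rw [EReal.coe_lt_coe_iff] at hr
  have hγ : HasDerivAt (fun s : ℝ => x + s • f x) (f x) 0 := by
    exact (((hasDerivAt_id (0 : ℝ)).smul_const (f x)).const_add x).congr_deriv (one_smul ℝ _)
  have h0 : x + (0 : ℝ) • f x = x := by simp
  have hev := h.eventually_slope_lt (γ := fun s : ℝ => x + s • f x) (t := 0) (r := r)
    (by simpa only [h0] using hγ.hasDerivWithinAt)
    (nhdsWithin_le_nhds (hγ.continuousAt.eventually_mem
      (by simpa only [h0] using mem_interior_iff_mem_nhds.1 hx)))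
    (by simpa only [h0] using hr)
  refine limsup_le_of_le (h := ?_)
  filter_upwards [hev] with s hs
  rw [EReal.coe_le_coe_iff, div_eq_inv_mul]
  simpa only [h0, sub_zero] using hs.le

/-- Grönwall's lemma in its Dini form, with negative rate `-b` and no error term. -/
lemma DecaysOn.cpa_le (h : T.DecaysOn f W I b) {x : ℝ → E n} {t₀ t₁ : ℝ}
    (hx : IsSolutionOn f x (Icc t₀ t₁)) (hI : ∀ t ∈ Icc t₀ t₁, x t ∈ T.union I) :
    ∀ t ∈ Icc t₀ t₁, T.cpa W (x t) ≤ T.cpa W (x t₀) * Real.exp (-b * (t - t₀)) := by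
  intro t ht
  rw [← gronwallBound_ε0]
  refine le_gronwallBound_of_liminf_deriv_right_le (f := fun t => T.cpa W (x t))
    (f' := fun t => -b * T.cpa W (x t)) ?_ ?_ le_rfl (fun _ _ => by simp) t ht
  · exact (T.continuousOn_cpa W).comp (fun s hs => (hx s hs).continuousWithinAt)
      fun s hs => T.union_subset_carrier I (hI s hs)
  · intro s hs r hr
    have hmem : Icc t₀ t₁ ∈ 𝓝[>] s :=
      nhdsWithin_mono s Ioi_subset_Ici_self
        (mem_of_superset (Icc_mem_nhdsGE hs.2) (Icc_subset_Icc_left hs.1))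
    refine (h.eventually_slope_lt ((hx s ⟨hs.1, hs.2.le⟩).mono_of_mem_nhdsWithin hmem) ?_
      hr).frequently
    filter_upwards [hmem] with s hs using hI s hs

/-- Solutions cannot leave an open set on whose boundary the interpolation of `W` is no smaller
than at the initial point. -/
lemma DecaysOn.mem_of_solution (h : T.DecaysOn f W I b) (hb : 0 < b) {G : Set (E n)}
    (hG : IsOpen G) (hGI : closure G ⊆ T.union I) {R : ℝ} (hR : 0 < R)
    (hfr : ∀ z ∈ frontier G, R ≤ T.cpa W z) {x : ℝ → E n} {t₀ t₁ : ℝ}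
    (hc : ContinuousOn x (Icc t₀ t₁))
    (hx : ∀ t ∈ Icc t₀ t₁, x t ∈ T.union I → HasDerivWithinAt x (f (x t)) (Icc t₀ t₁) t)
    (h0 : x t₀ ∈ G) (hV : T.cpa W (x t₀) ≤ R) : ∀ t ∈ Icc t₀ t₁, x t ∈ G := by
  intro t ht
  by_contra hbad
  have hcomp : IsCompact (Icc t₀ t₁ ∩ x ⁻¹' Gᶜ) :=
    isCompact_Icc.of_isClosed_subset
      (hc.preimage_isClosed_of_isClosed isClosed_Icc hG.isClosed_compl) inter_subset_left
  -- At the first exit time `s` the point lies on the frontier, so `V ≥ R`. But `V` has decayed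
  -- strictly below `R` over the positive time `s - t₀`.
  obtain ⟨s, ⟨hs, hsG⟩, hmin⟩ := hcomp.exists_isLeast ⟨t, ht, hbad⟩
  have hlt : t₀ < s := hs.1.lt_of_ne (by rintro rfl; exact hsG h0)
  have hin : ∀ r ∈ Ico t₀ s, x r ∈ G := fun r hr => by
    by_contra hrG
    exact absurd (hmin ⟨⟨hr.1, hr.2.le.trans hs.2⟩, hrG⟩) (not_le.2 hr.2)
  have hcl : x s ∈ closure G := by
    refine ((hc s hs).mono fun r (hr : r ∈ Ico t₀ s) =>
      ⟨hr.1, hr.2.le.trans hs.2⟩).mem_closure ?_ hin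
    rw [closure_Ico hlt.ne]
    exact right_mem_Icc.2 hlt.le
  have hfs : R ≤ T.cpa W (x s) := hfr _ ⟨hcl, fun h => hsG (interior_subset h)⟩
  have hI : ∀ r ∈ Icc t₀ s, x r ∈ T.union I := fun r hr => by
    rcases hr.2.eq_or_lt with rfl | hr'
    · exact hGI hcl
    · exact hGI (subset_closure (hin r ⟨hr.1, hr'⟩))
  have hsub : Icc t₀ s ⊆ Icc t₀ t₁ := Icc_subset_Icc_right hs.2
  have hle := h.cpa_le (fun r hr => (hx r (hsub hr) (hI r hr)).mono hsub) hI s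
    (right_mem_Icc.2 hlt.le)
  have hexp : Real.exp (-b * (s - t₀)) < 1 := by
    rw [← Real.exp_zero]; exact Real.exp_lt_exp.2 (by nlinarith)
  have : T.cpa W (x t₀) * Real.exp (-b * (s - t₀)) ≤ R * Real.exp (-b * (s - t₀)) :=
    mul_le_mul_of_nonneg_right hV (Real.exp_pos _).le
  nlinarith

/-- Solve for a globally Lipschitz extension of `f`. The curve never leaves `G`, where the extension
equals `f`; this is why `mem_of_solution` asks for the equation only at times when the curve is in
the good simplexes. -/
lemma DecaysOn.exists_solution (h : T.DecaysOn f W I b) (hb : 0 < b)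
    (hf : ∃ K, LipschitzOnWith K f T.carrier) {G : Set (E n)}
    (hG : IsOpen G) (hGI : closure G ⊆ T.union I) {R : ℝ} (hR : 0 < R)
    (hfr : ∀ z ∈ frontier G, R ≤ T.cpa W z) {x₀ : E n} (h0 : x₀ ∈ G) (hV : T.cpa W x₀ ≤ R)
    (t₀ : ℝ) : ∃ x : ℝ → E n, x t₀ = x₀ ∧ IsSolutionOn f x (Ici t₀) := by
  obtain ⟨K, hK⟩ := hf
  obtain ⟨F, hF, hFf⟩ := hK.extend_finite_dimension
  obtain ⟨x, hx0, hx⟩ := hF.exists_hasDerivWithinAt_Ici t₀ x₀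
  have hmem : ∀ t ∈ Ici t₀, x t ∈ G := fun t ht =>
    h.mem_of_solution hb hG hGI hR hfr
      (fun s hs => ((hx s hs.1).mono Icc_subset_Ici_self).continuousWithinAt)
      (fun s hs hs' => by
        rw [hFf (T.union_subset_carrier I hs')]
        exact (hx s hs.1).mono Icc_subset_Ici_self)
      (hx0 ▸ h0) (hx0 ▸ hV) t (right_mem_Icc.2 ht)
  refine ⟨x, hx0, fun t ht => ?_⟩
  rw [hFf (T.union_subset_carrier I (hGI (subset_closure (hmem t ht))))]
  exact hx t ht

lemma DecaysOn.locallyExponentiallyStable (h : T.DecaysOn f W I b) (hb : 0 < b)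
    (hf : ∃ K, LipschitzOnWith K f T.carrier) (hf0 : f 0 = 0) (hI : T.union I ∈ 𝓝 0)
    (hW0 : T.cpa W 0 = 0) {c : ℝ} (hc : 0 < c) (hcW : ∀ x ∈ T.carrier, c * ‖x‖ ≤ T.cpa W x) :
    LocallyExponentiallyStable f := by
  obtain ⟨ρ, hρ, hball⟩ := Metric.nhds_basis_closedBall.mem_iff.1 hI
  obtain ⟨K, hK⟩ := T.exists_lipschitzOnWith_cpa W
  have hupper : ∀ x ∈ T.carrier, T.cpa W x ≤ (K + 1) * ‖x‖ := fun x hx => by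
    have := hK.dist_le_mul x hx 0 (interior_subset T.zero_mem_interior_carrier)
    rw [hW0, dist_zero_right, dist_zero_right, Real.norm_eq_abs] at this
    nlinarith [le_abs_self (T.cpa W x), norm_nonneg x]
  have hK1 : (0 : ℝ) < K + 1 := by positivity
  have hcl : closure (Metric.ball (0 : E n) ρ) ⊆ T.union I :=
    Metric.closure_ball_subset_closedBall.trans hball
  have hfr : ∀ z ∈ frontier (Metric.ball (0 : E n) ρ), c * ρ ≤ T.cpa W z := fun z hz => by
    have h1 : ‖z‖ = ρ := by simpa using Metric.frontier_ball_subset_sphere hz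
    rw [← h1]
    exact hcW z (T.union_subset_carrier I (hcl (frontier_subset_closure hz)))
  -- This radius gives `V x₀ ≤ c ρ`, a lower bound for `V` on the sphere of radius `ρ`, so solutions
  -- are trapped in the ball. The constant `(K + 1) / c` is the ratio of the two linear bounds on
  -- `V`.
  refine ⟨hf0, min ρ (c * ρ / (K + 1)), by positivity, (K + 1) / c, by positivity, b, hb,
    fun t₀ x₀ hx₀ => ?_⟩
  have hin : x₀ ∈ Metric.ball (0 : E n) ρ := by simpa using hx₀.trans_le (min_le_left _ _)
  have hV0 := hupper x₀ (T.union_subset_carrier I (hcl (subset_closure hin)))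
  have hV : T.cpa W x₀ ≤ c * ρ := by
    have h1 := (lt_div_iff₀ hK1).1 (hx₀.trans_le (min_le_right _ _))
    linarith
  refine ⟨h.exists_solution hb hf Metric.isOpen_ball hcl (mul_pos hc hρ) hfr hin hV t₀,
    fun t₁ x hx0 hx t ht => ?_⟩
  have hmem := fun s hs => hcl (subset_closure (h.mem_of_solution hb Metric.isOpen_ball hcl
    (mul_pos hc hρ) hfr (fun s hs => (hx s hs).continuousWithinAt) (fun s hs _ => hx s hs)
    (hx0 ▸ hin) (hx0 ▸ hV) s hs))
  have h1 := h.cpa_le hx hmem t ht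
  have h2 := hcW _ (T.union_subset_carrier I (hmem t ht))
  rw [hx0] at h1
  have h3 := mul_le_mul_of_nonneg_right hV0 (Real.exp_pos (-b * (t - t₀))).le
  have h4 : c * ‖x t‖ ≤ (K + 1) * ‖x₀‖ * Real.exp (-b * (t - t₀)) := h2.trans (h1.trans h3)
  rw [mul_comm, ← le_div_iff₀ hc] at h4
  refine h4.trans_eq ?_
  ring

end Triangulation

/-! ### Norm estimates and conclusion -/

lemma le_rpow_mul_exp_of_mul_rpow_le {a b₁ b r s ρ : ℝ} (ha : 0 < a) (hb₁ : 0 < b₁) (hr : 0 < r)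
    (hρ : 0 ≤ ρ) (h : b₁ * ρ ^ a ≤ r * Real.exp (-b * s)) :
    ρ ≤ (r / b₁) ^ (1 / a) * Real.exp (-(b / a) * s) := by
  have h1 : ρ ^ a ≤ r / b₁ * Real.exp (-b * s) := by
    rw [mul_comm, ← le_div_iff₀ hb₁] at h
    exact h.trans_eq (by ring)
  calc ρ = (ρ ^ a) ^ (1 / a) := by
        rw [← Real.rpow_mul hρ, mul_one_div_cancel ha.ne', Real.rpow_one]
    _ ≤ (r / b₁ * Real.exp (-b * s)) ^ (1 / a) := by gcongr
    _ = _ := by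
        rw [Real.mul_rpow (by positivity) (Real.exp_pos _).le, ← Real.exp_mul]
        congr 2
        ring

end

theorem corollary1 {n m : ℕ} (hn : 1 ≤ n) {Λ : Type*}
    (g : E n → E m → E n) (hg : g 0 0 = 0)
    (X : Set (E n)) (hX : IsRegion X) (U : Set (E m)) (hU : IsRegion U)
    (T : Triangulation n) (hTX : T.carrier ⊆ X)
    (u : Λ → E n → E m) (hu : ControllerClass T g U u)
    (β : Λ → Fin T.m → ℝ) (hβ : IsHessianBound T g U u β)
    (J : Decision T Λ → ℝ) (y : Decision T Λ) (hopt : y.IsOptimal g U u β J)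
    (hb₂ : y.b₂ ≤ 0)
    (hI : ∀ i, (0 : E n) ∈ T.simplex i → i ∈ y.goodSimplexes g u β) :
    -- the minimum defining the decay rate `b` exists and is positive
    ∃ b : ℝ, IsLeast (y.decayRates g u β) b ∧ 0 < b ∧
    -- a subcollection of the good simplexes forms a region
    (∃ I ⊆ y.goodSimplexes g u β, IsRegion (T.union I)) ∧
    LocallyExponentiallyStable (closedLoop g u y.lam) ∧
    ∀ Ω : Set (E n), IsRegion Ω → Ω ⊆ T.union (y.goodSimplexes g u β) →
      (∃ a b₁ : ℝ, IsLyapunov (closedLoop g u y.lam) Ω (T.cpa y.V) a b₁ b) ∧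
      (1 ≤ y.a → IsLyapunov (closedLoop g u y.lam) Ω (T.cpa y.V) y.a y.b₁ b) ∧
      ∀ r : ℝ, 0 < r → ∀ A : Set (E n), A = {x ∈ Ω | T.cpa y.V x ∈ Set.Icc 0 r} → IsRegion A →
        -- estimates for as long as a solution stays in `Ω`
        (∀ (t₀ t₁ : ℝ) (x : ℝ → E n), x t₀ ∈ interior A →
          IsSolutionOn (closedLoop g u y.lam) x (Set.Icc t₀ t₁) →
          (∀ t ∈ Set.Icc t₀ t₁, x t ∈ Ω) →
          ∀ t ∈ Set.Icc t₀ t₁,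
            T.cpa y.V (x t) ≤ r * Real.exp (-b * (t - t₀)) ∧
            (1 ≤ y.a →
              ‖x t‖ ≤ (r / y.b₁) ^ (1 / y.a) * Real.exp (-(b / y.a) * (t - t₀)))) ∧
        -- if `V = r` on the boundary of `A`, solutions from the interior of `A` exist for all
        -- future time and never leave it, so that the estimates hold for all `t ≥ t₀`
        ((∀ z ∈ frontier A, T.cpa y.V z = r) → ∀ (t₀ : ℝ), ∀ x₀ ∈ interior A,
          (∃ x : ℝ → E n, x t₀ = x₀ ∧
            IsSolutionOn (closedLoop g u y.lam) x (Set.Ici t₀)) ∧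
          ∀ (t₁ : ℝ) (x : ℝ → E n), x t₀ = x₀ →
            IsSolutionOn (closedLoop g u y.lam) x (Set.Icc t₀ t₁) →
            ∀ t ∈ Set.Icc t₀ t₁, x t ∈ interior A ∧
              T.cpa y.V (x t) ≤ r * Real.exp (-b * (t - t₀)) ∧
              (1 ≤ y.a →
                ‖x t‖ ≤ (r / y.b₁) ^ (1 / y.a) * Real.exp (-(b / y.a) * (t - t₀)))) := by
  have hy := hopt.1
  set f := closedLoop g u y.lam with hf
  set I := y.goodSimplexes g u β with hIdef
  obtain ⟨b, hb, hb0⟩ := Decision.exists_isLeast_decayRates hn hy hI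
  have hdec : T.DecaysOn f y.V I b := fun i hi x hx =>
    Decision.inner_grad_le hg hu hβ hy hb.2 hi hx
  have hlip : ∃ K, LipschitzOnWith K f T.carrier := hu.lipschitz_closedLoop y.lam
  have hstar : {i | (0 : E n) ∈ T.simplex i} ⊆ I := fun i hi => hI i hi
  have hnhds : T.union I ∈ 𝓝 0 := mem_of_superset
    (mem_interior_iff_mem_nhds.1 T.isRegion_star.zero_mem) (biUnion_subset_biUnion_left hstar)
  obtain ⟨c, hc, hcV⟩ := T.exists_mul_norm_le hy.V_zero fun v hv => hy.V_pos hv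
  have hlin : ∀ x ∈ T.carrier, c * ‖x‖ ^ (1 : ℝ) ≤ T.cpa y.V x := fun x hx =>
    T.mul_norm_rpow_le_cpa le_rfl hc.le (by simpa using hcV) hx
  refine ⟨b, hb, hb0, ⟨_, hstar, T.isRegion_star⟩,
    hdec.locallyExponentiallyStable hb0 hlip (Decision.closedLoop_zero hg hu y.lam) hnhds
      hy.cpa_zero hc (by simpa using hlin), fun Ω hΩ hΩI => ?_⟩
  have hΩT : Ω ⊆ T.carrier := hΩI.trans (T.union_subset_carrier I)
  have hlow : 1 ≤ y.a → ∀ x ∈ Ω, y.b₁ * ‖x‖ ^ y.a ≤ T.cpa y.V x := fun ha x hx =>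
    T.mul_norm_rpow_le_cpa ha hy.b₁_pos.le hy.lower_all (hΩT hx)
  have hV : ∀ a b₁ : ℝ, 0 < a → 0 < b₁ → (∀ x ∈ Ω, b₁ * ‖x‖ ^ a ≤ T.cpa y.V x) →
      IsLyapunov f Ω (T.cpa y.V) a b₁ b := fun a b₁ ha hb₁ hl =>
    { lipschitz := (T.exists_lipschitzOnWith_cpa y.V).imp fun _ hK => hK.mono hΩT
      zero := hy.cpa_zero
      a_pos := ha
      b₁_pos := hb₁
      b₂_pos := hb0
      lower := hl
      decrease := fun x hx => hdec.diniDeriv_le (interior_mono hΩI hx.1) }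
  refine ⟨⟨1, c, hV 1 c one_pos hc fun x hx => hlin x (hΩT hx)⟩,
    fun ha => hV y.a y.b₁ hy.a_pos hy.b₁_pos (hlow ha), fun r hr A hA hAR => ?_⟩
  have hAΩ : A ⊆ Ω := hA ▸ sep_subset _ _
  have hAr : ∀ z ∈ A, T.cpa y.V z ≤ r := fun z hz => by
    rw [hA] at hz
    exact hz.2.2
  have hest : ∀ (t₀ t₁ : ℝ) (x : ℝ → E n), x t₀ ∈ interior A →
      IsSolutionOn f x (Icc t₀ t₁) → (∀ t ∈ Icc t₀ t₁, x t ∈ Ω) → ∀ t ∈ Icc t₀ t₁,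
      T.cpa y.V (x t) ≤ r * Real.exp (-b * (t - t₀)) ∧ (1 ≤ y.a →
        ‖x t‖ ≤ (r / y.b₁) ^ (1 / y.a) * Real.exp (-(b / y.a) * (t - t₀))) := by
    intro t₀ t₁ x hx0 hx hxΩ t ht
    have h1 : T.cpa y.V (x t) ≤ r * Real.exp (-b * (t - t₀)) :=
      (hdec.cpa_le hx (fun s hs => hΩI (hxΩ s hs)) t ht).trans
        (mul_le_mul_of_nonneg_right (hAr _ (interior_subset hx0)) (Real.exp_pos _).le)
    exact ⟨h1, fun ha => le_rpow_mul_exp_of_mul_rpow_le hy.a_pos hy.b₁_pos hr (norm_nonneg _)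
      ((hlow ha _ (hxΩ t ht)).trans h1)⟩
  refine ⟨hest, fun hfr t₀ x₀ hx₀ => ?_⟩
  -- Invariance is applied to the open set `interior A`: its closure is `A` because `A` is a region,
  -- and its frontier lies in that of `A`, where `V = r`.
  have hcl : closure (interior A) ⊆ T.union I := by
    rw [hAR.closure_interior]
    exact hAΩ.trans hΩI
  have hfr' : ∀ z ∈ frontier (interior A), r ≤ T.cpa y.V z := fun z hz =>
    (hfr z (frontier_interior_subset hz)).ge
  have hVx₀ : T.cpa y.V x₀ ≤ r := hAr _ (interior_subset hx₀)
  refine ⟨hdec.exists_solution hb0 hlip isOpen_interior hcl hr hfr' hx₀ hVx₀ t₀,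
    fun t₁ x hx0 hx t ht => ?_⟩
  have hmem := hdec.mem_of_solution hb0 isOpen_interior hcl hr hfr'
    (fun s hs => (hx s hs).continuousWithinAt) (fun s hs _ => hx s hs)
    (hx0 ▸ hx₀) (hx0 ▸ hVx₀)
  exact ⟨hmem t ht, hest t₀ t₁ x (hx0 ▸ hx₀) hx (fun s hs => hAΩ (interior_subset (hmem s hs)))
    t ht⟩
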